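/- For a non-constant polynomial $f\in\mathbb{C}[x]$, the roots of maximal modulus of $f$ are the complex roots of $f$ whose absolute value equals the maximum of the absolute values of all roots of $f$; they are counted with multiplicity. The height of $f$ is the maximum of the absolute values of its coefficients. For positive integers $k\le n$ and $H$, let $R_n(k,H)$ be the number of monic polynomials $f\in\mathbb{Z}[x]$ of degree $n$ and height at most $H$ that are reducible in $\mathbb{Z}[x]$ and have exactly $k$ (not necessarily distinct) roots of maximal modulus. Put $$e(n,k)=\begin{cases}\dfrac{n+1}{2}-k+\dfrac{5k^2-4k+7}{8n} & \text{if } k \text{ is odd},\\[2mm] \dfrac{n+1}{2}-k+\dfrac{5k^2-2k+16}{8n} & \text{if } k \text{ is even}.\end{cases}$$ Write $U\ll V$, or equivalently $V\gg U$, if $U\le cV$ for some constant $c>0$ that may depend on $n$ and $k$ but not on $H$, and write $U\asymp V$ if $U\ll V\ll U$. **Theorem.** We have $$R_2(1,H)\asymp H\log H \quad (H\ge 2), \qquad R_2(2,H)\asymp H^{1/2} \quad (H\ge 1).$$ For any integers $n\ge 3$, $1\le k\le n$ and $H\ge 1$, $$R_n(k,H)\ll H^{\,n-(k+1)/2},$$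 and also, except when $k=n$ is even, $$R_n(k,H)\gg H^{\,e(n,k)}.$$ Finally, for $n\ge 3$, in the case when $k=n$ is even, for any integer $H\ge 1$, $$R_n(n,H)\gg H^{\,\frac n8+\frac 2n-\frac14}.$$ -/

import Mathlib

open Polynomial

noncomputable section

/-- The number of roots of maximal modulus (dominant roots) of an integer polynomial: its complex
roots `z`, counted with multiplicity, such that every complex root `w` satisfies `‖w‖ ≤ ‖z‖`. -/
def numDominantRoots (f : ℤ[X]) : ℕ :=
  open Classical in
  ((f.aroots ℂ).filter fun z => ∀ w ∈ f.aroots ℂ, ‖w‖ ≤ ‖z‖).card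

/-- The monic integer polynomials of degree `n`, of height at most `H`, with exactly `k` roots of
maximal modulus (counted with multiplicity). The height, the largest absolute value of a
coefficient, is Mathlib's `Polynomial.supNorm`. -/
def dominantPolys (n k H : ℕ) : Set ℤ[X] :=
  {f | f.Monic ∧ f.natDegree = n ∧ f.supNorm ≤ (H : ℝ) ∧ numDominantRoots f = k}

/-- The number `R_n(k,H)` of reducible polynomials in `dominantPolys n k H`. A monic polynomial of
degree `n ≥ 1` is neither zero nor a unit, so it is reducible in `ℤ[X]` exactly when it is not
irreducible there. -/
def reducibleCount (n k H : ℕ) : ℕ :=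
  {f ∈ dominantPolys n k H | ¬ Irreducible f}.ncard

/-- The exponent `e(n,k)`. -/
def lowerExponent (n k : ℕ) : ℝ :=
  if Odd k then
    ((n : ℝ) + 1) / 2 - k + (5 * (k : ℝ) ^ 2 - 4 * k + 7) / (8 * n)
  else
    ((n : ℝ) + 1) / 2 - k + (5 * (k : ℝ) ^ 2 - 2 * k + 16) / (8 * n)

/-- The polynomials counted form a finite set, so that `Set.ncard` is their true number. -/
theorem dominantPolys_finite (n k H : ℕ) : (dominantPolys n k H).Finite := by
  have hfin : (Set.pi Set.univ
      (fun _ : Fin (n + 1) => Set.Icc (-(H : ℤ)) (H : ℤ))).Finite :=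
    Set.Finite.pi fun _ => Set.finite_Icc _ _
  refine Set.Finite.of_finite_image (f := fun f : ℤ[X] => fun i : Fin (n + 1) => f.coeff i)
    (hfin.subset ?_) ?_
  · rintro _ ⟨f, ⟨-, -, hH, -⟩, rfl⟩ i -
    have h : ‖f.coeff i‖ ≤ (H : ℝ) := (f.le_supNorm i).trans hH
    rw [Int.norm_eq_abs] at h
    exact abs_le.mp (by exact_mod_cast h)
  · intro f hf g hg hfg
    ext i
    by_cases hi : i < n + 1
    · exact congrFun hfg ⟨i, hi⟩
    · have h1 : f.natDegree = n := hf.2.1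
      have h2 : g.natDegree = n := hg.2.1
      rw [coeff_eq_zero_of_natDegree_lt (by omega), coeff_eq_zero_of_natDegree_lt (by omega)]

end

/-! Upper bound. A reducible monic `f` is a product `g * h` of monic factors. The Mahler measure is
multiplicative and at most `(n + 1) * H` at `f`. If `κ` roots of a monic polynomial of degree `d`
and measure at most `t` share the maximal modulus `r`, then `max 1 r ^ κ ≤ t`, so the coefficient of
index `d - j` is `≪ t ^ min(1, j / κ)`. Multiplying these ranges leaves `≪ t ^ (d - (κ - 1) / 2)`
polynomials. If both factors carry dominant roots of `f`, their moduli agree, so `h` prescribes the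
modulus for `g`. That costs `g` a full power of `t`: once the other coefficients are fixed,
boundedly many constant coefficients allow a root of given modulus (`card_le_of_root_norm`). Summing
over dyadic ranges of the measure of `h` gives a geometric series, hence the larger end term
(`exists_card_products_le`). The series degenerates into a logarithm only if both end terms have the
same exponent, which for `n ≥ 3` does not happen.

Lower bound. If all roots of `A` lie in `|z| < √R` and `deg A = l ≥ 1`, then `z ^ l * (A(z) + A(R /
z))` has all its roots on `|z| = √R`: inversion in the circle moves an outside point strictly closer
to every root of `A`, so `|A(z)| ≠ |A(R / z)|` off the circle (`norm_root_selfRecip`). Such a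
polynomial, times a fixed small factor `E` with roots on the circle, times any polynomial with all
roots inside, is reducible with a prescribed number of dominant roots. Counting coefficients and
summing over radii up to about `H ^ (1 / n)` gives the exponents. The choice of `E` (`1`, `X - i` or
`X ^ 2 - i`) distinguishes the three cases.

For `n = 2` everything reduces to counting integer pairs `(a, b)` with `|a * b| ≤ H` and `|a + b| ≤
H`. -/

open Polynomial

/-! ### Boxes of monic integer polynomials. -/

/-- The monic integer polynomials of degree `m` whose lower coefficients satisfy `|aᵢ| ≤ β i`. -/
noncomputable def monicBox (m : ℕ) (β : ℕ → ℝ) : Finset ℤ[X] :=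
  open Classical in
  (Fintype.piFinset fun i : Fin m => Finset.Icc (-(⌊β i⌋₊ : ℤ)) ⌊β i⌋₊).image
    fun v => X ^ m + ∑ i : Fin m, C (v i) * X ^ (i : ℕ)

theorem coeff_X_pow_add_sum {m : ℕ} (v : Fin m → ℤ) (i : Fin m) :
    (X ^ m + ∑ i : Fin m, C (v i) * X ^ (i : ℕ) : ℤ[X]).coeff i = v i := by
  have h := i.2.ne
  simp [coeff_X_pow, h, Fin.val_inj]

theorem card_monicBox (m : ℕ) (β : ℕ → ℝ) :
    (monicBox m β).card = ∏ i ∈ Finset.range m, (2 * ⌊β i⌋₊ + 1) := by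
  classical
  rw [monicBox, Finset.card_image_of_injective, Fintype.card_piFinset, Finset.prod_range]
  · refine Finset.prod_congr rfl fun i _ => ?_
    rw [Int.card_Icc]
    omega
  · intro v w h
    ext i
    rw [← coeff_X_pow_add_sum v i, ← coeff_X_pow_add_sum w i]
    exact congrArg (fun f => coeff f (i : ℕ)) h

theorem mem_monicBox {m : ℕ} {β : ℕ → ℝ} (hβ : ∀ i < m, 0 ≤ β i) {f : ℤ[X]} :
    f ∈ monicBox m β ↔ f.Monic ∧ f.natDegree = m ∧ ∀ i < m, |(f.coeff i : ℝ)| ≤ β i := by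
  classical
  have key : ∀ i < m, ∀ c : ℤ, c ∈ Finset.Icc (-(⌊β i⌋₊ : ℤ)) ⌊β i⌋₊ ↔ |(c : ℝ)| ≤ β i := by
    intro i hi c
    rw [Finset.mem_Icc, ← abs_le, ← Int.natCast_natAbs, Nat.cast_le, Nat.le_floor_iff (hβ i hi),
      Nat.cast_natAbs, Int.cast_abs]
  constructor
  · intro h
    obtain ⟨v, hv, rfl⟩ := Finset.mem_image.1 h
    refine ⟨monic_X_pow_add (degree_sum_fin_lt v), ?_, fun i hi => ?_⟩
    · rw [natDegree_add_eq_left_of_degree_lt, natDegree_X_pow]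
      simpa using degree_sum_fin_lt v
    · have := coeff_X_pow_add_sum v ⟨i, hi⟩
      simp only at this
      rw [this, ← key i hi]
      exact Fintype.mem_piFinset.1 hv ⟨i, hi⟩
  · rintro ⟨hm, hd, hc⟩
    refine Finset.mem_image.2 ⟨fun i => f.coeff i, Fintype.mem_piFinset.2 fun i => ?_, ?_⟩
    · exact (key i i.2 _).2 (hc i i.2)
    · conv_rhs => rw [hm.as_sum, hd]
      rw [Finset.sum_range]

theorem card_monicBox_le {m : ℕ} {β : ℕ → ℝ} (hβ : ∀ i < m, 1 ≤ β i) :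
    ((monicBox m β).card : ℝ) ≤ 3 ^ m * ∏ i ∈ Finset.range m, β i := by
  rw [card_monicBox]
  push_cast
  calc _ ≤ ∏ i ∈ Finset.range m, (3 * β i) := by
        refine Finset.prod_le_prod (fun i _ => by positivity) fun i hi => ?_
        have h1 := hβ i (Finset.mem_range.1 hi)
        have h2 := Nat.floor_le (zero_le_one.trans h1)
        linarith
    _ = _ := by rw [Finset.prod_mul_distrib]; simp

theorem prod_le_card_monicBox {m : ℕ} {β : ℕ → ℝ} (hβ : ∀ i < m, 0 ≤ β i) :
    ∏ i ∈ Finset.range m, β i ≤ ((monicBox m β).card : ℝ) := by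
  rw [card_monicBox]
  push_cast
  refine Finset.prod_le_prod (fun i hi => hβ i (Finset.mem_range.1 hi)) fun i hi => ?_
  have := Nat.lt_floor_add_one (β i)
  have : (0 : ℝ) ≤ ⌊β i⌋₊ := by positivity
  linarith

/-! ### Inversion in a circle, and polynomials having a root of given modulus. -/

/-- The polynomial `∑ aᵢ Rⁱ X^(m-i)`, which is `X ^ m * A (R / X)`. -/
noncomputable def invRev {S : Type*} [CommRing S] (R : S) (m : ℕ) (A : S[X]) : S[X] :=
  ∑ i ∈ Finset.range (m + 1), C (A.coeff i * R ^ i) * X ^ (m - i)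

theorem eval_invRev {S : Type*} [CommRing S] {R z w : S} (h : z * w = R) {m : ℕ} {A : S[X]}
    (hA : A.natDegree ≤ m) : (invRev R m A).eval z = z ^ m * A.eval w := by
  rw [invRev, eval_finsetSum, eval_eq_sum_range' (Nat.lt_succ_of_le hA), Finset.mul_sum]
  refine Finset.sum_congr rfl fun i hi => ?_
  have hi : i ≤ m := Nat.lt_succ_iff.1 (Finset.mem_range.1 hi)
  simp only [eval_mul, eval_C, eval_pow, eval_X]
  rw [← h, mul_pow]
  conv_rhs => rw [← Nat.sub_add_cancel hi, pow_add]
  ring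

theorem natDegree_invRev_le {S : Type*} [CommRing S] (R : S) (m : ℕ) (A : S[X]) :
    (invRev R m A).natDegree ≤ m :=
  natDegree_sum_le_of_forall_le _ _ fun _ _ => (natDegree_C_mul_X_pow_le _ _).trans (Nat.sub_le _ _)

theorem map_invRev {S T : Type*} [CommRing S] [CommRing T] (φ : S →+* T) (R : S) (m : ℕ)
    (A : S[X]) : (invRev R m A).map φ = invRev (φ R) m (A.map φ) := by
  simp [invRev, Polynomial.map_sum]

theorem coeff_invRev_self {S : Type*} [CommRing S] (R : S) (m : ℕ) (A : S[X]) :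
    (invRev R m A).coeff m = A.coeff 0 := by
  rw [invRev, finsetSum_coeff, Finset.sum_eq_single 0]
  · simp
  · intro i hi h0
    have hi := Finset.mem_range.1 hi
    rw [coeff_C_mul_X_pow, if_neg (by omega)]
  · simp

/-- Among monic polynomials with prescribed non-constant coefficients, at most `2 * m` have a root
of given modulus. -/
theorem card_le_of_root_norm {m : ℕ} (hm : 1 ≤ m) (r : ℝ) (P : ℤ[X]) (hP : P.Monic)
    (hd : P.natDegree = m) (s : Finset ℤ)
    (hs : ∀ c ∈ s, ∃ z : ℂ, ‖z‖ = r ∧ aeval z (P + C c) = 0) : s.card ≤ 2 * m := by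
  classical
  set A : ℂ[X] := P.map (algebraMap ℤ ℂ)
  have hA : A.Monic := hP.map _
  have hAd : A.natDegree = m := by rw [hP.natDegree_map, hd]
  -- `Q` does not depend on `c`. If `P + c` vanishes at `z` with `|z| = r`, then `r ^ 2 / z` is the
  -- conjugate of `z`, and `A` takes the same real value `-c` at both points, so `z` is a root of
  -- `Q`. Conversely `z` determines `c = -A(z)`.
  set Q : ℂ[X] := X ^ m * A - invRev ((r : ℂ) ^ 2) m A
  have hXA : (X ^ m * A).natDegree = 2 * m := by
    rw [(monic_X_pow m).natDegree_mul hA, natDegree_X_pow, hAd]; ring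
  have hlt : (invRev ((r : ℂ) ^ 2) m A).degree < (X ^ m * A).degree := by
    refine degree_lt_degree ?_
    rw [hXA]
    exact (natDegree_invRev_le _ _ _).trans_lt (by omega)
  have hQd : Q.natDegree = 2 * m := by
    rw [natDegree_sub_eq_left_of_natDegree_lt, hXA]
    rw [hXA]
    exact (natDegree_invRev_le _ _ _).trans_lt (by omega)
  have hQ0 : Q ≠ 0 := by
    rintro h
    rw [h, natDegree_zero] at hQd
    omega
  have hA0 : ∀ c : ℤ, ∀ z : ℂ, aeval z (P + C c) = 0 → A.eval z = -(c : ℂ) := by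
    intro c z h
    rw [map_add, aeval_C, ← eval_map_algebraMap] at h
    exact eq_neg_of_add_eq_zero_left h
  choose! z hz using hs
  have hmaps : ∀ c ∈ s, z c ∈ Q.roots.toFinset := by
    intro c hc
    rw [Multiset.mem_toFinset, mem_roots hQ0, IsRoot.def]
    obtain ⟨h1, h2⟩ := hz c hc
    have h3 : z c * (starRingEnd ℂ) (z c) = (r : ℂ) ^ 2 := by
      rw [Complex.mul_conj, Complex.normSq_eq_norm_sq, h1]
      push_cast; rfl
    have h4 : A.eval ((starRingEnd ℂ) (z c)) = (starRingEnd ℂ) (A.eval (z c)) := by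
      simp only [A, eval_map_algebraMap, aeval_def, hom_eval₂]
      congr 1
      ext; simp
    have h5 := hA0 c _ h2
    simp only [Q, eval_sub, eval_mul, eval_pow, eval_X]
    rw [eval_invRev h3 hAd.le, h4, h5]
    simp
  have hinj : Set.InjOn z s := by
    intro c hc d hd h
    have h1 := hA0 c _ (hz c hc).2
    rw [h, hA0 d _ (hz d hd).2] at h1
    exact_mod_cast (neg_injective h1).symm
  calc s.card ≤ Q.roots.toFinset.card := Finset.card_le_card_of_injOn z hmaps hinj
    _ ≤ Multiset.card Q.roots := Multiset.toFinset_card_le _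
    _ ≤ 2 * m := (card_roots' Q).trans hQd.le

theorem monic_divX {f : ℤ[X]} {m : ℕ} (hf : f.Monic) (hd : f.natDegree = m + 1) : f.divX.Monic := by
  rw [Monic, leadingCoeff, natDegree_divX_eq_natDegree_tsub_one, coeff_divX, hd]
  rw [Monic, leadingCoeff, hd] at hf
  exact hf

/-- Prescribing the modulus of one root saves the choice of the constant coefficient. -/
theorem card_filter_root_norm_le {m : ℕ} {β : ℕ → ℝ} (hβ : ∀ i < m + 1, 0 ≤ β i) (r : ℝ)
    (s : Finset ℤ[X]) (hs : ∀ f ∈ s, f ∈ monicBox (m + 1) β)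
    (hr : ∀ f ∈ s, ∃ z : ℂ, ‖z‖ = r ∧ aeval z f = 0) :
    s.card ≤ 2 * (m + 1) * (monicBox m fun i => β (i + 1)).card := by
  classical
  refine Finset.card_le_mul_card_image_of_maps_to (f := divX) (fun f hf => ?_) _ fun q _ => ?_
  · obtain ⟨h1, h2, h3⟩ := (mem_monicBox hβ).1 (hs f hf)
    refine (mem_monicBox fun i hi => hβ _ (by omega)).2 ⟨monic_divX h1 h2, ?_, fun i hi => ?_⟩
    · rw [natDegree_divX_eq_natDegree_tsub_one, h2]; rfl
    · rw [coeff_divX]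
      exact h3 _ (by omega)
  · rcases Finset.eq_empty_or_nonempty {f ∈ s | f.divX = q} with h | ⟨f₀, hf₀⟩
    · simp [h]
    obtain ⟨hf₁, rfl⟩ := Finset.mem_filter.1 hf₀
    obtain ⟨h1, h2, -⟩ := (mem_monicBox hβ).1 (hs f₀ hf₁)
    -- The fibre of `divX` consists of the polynomials `P + c`, which differ only in the constant
    -- coefficient.
    set P : ℤ[X] := f₀.divX * X
    have hPm : P.Monic := (monic_divX h1 h2).mul monic_X
    have hPd : P.natDegree = m + 1 := by
      rw [(monic_divX h1 h2).natDegree_mul monic_X, natDegree_divX_eq_natDegree_tsub_one, h2,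
        natDegree_X]
      rfl
    have heq : ∀ f ∈ ({f ∈ s | f.divX = f₀.divX} : Finset ℤ[X]), P + C (f.coeff 0) = f := by
      intro f hf
      simp only [P]
      rw [← (Finset.mem_filter.1 hf).2, divX_mul_X_add]
    rw [← Finset.card_image_of_injOn (f := fun f : ℤ[X] => f.coeff 0)]
    · refine card_le_of_root_norm (by omega) r P hPm hPd _ fun c hc => ?_
      obtain ⟨f, hf, rfl⟩ := Finset.mem_image.1 hc
      rw [heq f hf]
      exact hr f (Finset.mem_filter.1 hf).1
    · intro f hf g hg h
      simp only at h
      rw [← heq f hf, ← heq g hg, h]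

/-! ### Mahler measure, coefficients and roots on a circle. -/

/-- The Mahler measure of an integer polynomial. -/
noncomputable def intMahler (f : ℤ[X]) : ℝ := (f.map (algebraMap ℤ ℂ)).mahlerMeasure

/-- The number of complex roots of modulus `r`, with multiplicity. -/
noncomputable def numRootsNorm (f : ℤ[X]) (r : ℝ) : ℕ :=
  open Classical in ((f.aroots ℂ).filter fun z => ‖z‖ = r).card

theorem intMahler_mul (f g : ℤ[X]) : intMahler (f * g) = intMahler f * intMahler g := by
  simp [intMahler, Polynomial.map_mul, mahlerMeasure_mul]

theorem one_le_intMahler {f : ℤ[X]} (hf : f.Monic) : 1 ≤ intMahler f :=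
  one_le_mahlerMeasure_of_ne_zero hf.ne_zero

theorem intMahler_le {f : ℤ[X]} {H : ℝ} (hH : f.supNorm ≤ H) :
    intMahler f ≤ (f.natDegree + 1) * H := by
  refine (mahlerMeasure_le_sum_norm_coeff _).trans ?_
  rw [Polynomial.sum_over_range' _ (by simp) (f.natDegree + 1)
    (Nat.lt_succ_of_le natDegree_map_le)]
  calc _ ≤ ∑ _i ∈ Finset.range (f.natDegree + 1), H := by
        refine Finset.sum_le_sum fun i _ => le_trans ?_ hH
        rw [coeff_map]
        simpa [Int.norm_eq_abs] using f.le_supNorm i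
    _ = _ := by simp

theorem abs_coeff_le_intMahler (f : ℤ[X]) (i : ℕ) :
    |(f.coeff i : ℝ)| ≤ 2 ^ f.natDegree * intMahler f := by
  have h := norm_coeff_le_choose_mul_mahlerMeasure i (f.map (algebraMap ℤ ℂ))
  rw [coeff_map] at h
  have hd : (f.map (algebraMap ℤ ℂ)).natDegree = f.natDegree :=
    natDegree_map_eq_of_injective (algebraMap ℤ ℂ).injective_int f
  rw [hd] at h
  have h2 : ((f.natDegree.choose i : ℕ) : ℝ) ≤ 2 ^ f.natDegree := by
    exact_mod_cast Nat.choose_le_two_pow _ _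
  refine le_trans (by simpa [intMahler] using h) (mul_le_mul_of_nonneg_right h2 (mahlerMeasure_nonneg _))

theorem abs_coeff_le_of_roots {f : ℤ[X]} (hf : f.Monic) {B : ℝ} (hB : 0 ≤ B)
    (h : ∀ z ∈ f.aroots ℂ, ‖z‖ ≤ B) (i : ℕ) :
    |(f.coeff i : ℝ)| ≤ 2 ^ f.natDegree * B ^ (f.natDegree - i) := by
  have h1 := coeff_le_of_roots_le (f := algebraMap ℤ ℂ) i hf (IsAlgClosed.splits _) h
  rw [coeff_map] at h1
  have h2 : ((f.natDegree.choose i : ℕ) : ℝ) ≤ 2 ^ f.natDegree := by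
    exact_mod_cast Nat.choose_le_two_pow _ _
  calc |(f.coeff i : ℝ)| ≤ B ^ (f.natDegree - i) * f.natDegree.choose i := by simpa using h1
    _ ≤ B ^ (f.natDegree - i) * 2 ^ f.natDegree := by gcongr
    _ = _ := mul_comm _ _

/-- The measure of a monic polynomial is the product of `max 1 ‖z‖` over its roots; the roots off
the circle contribute factors at least `1`. -/
theorem max_one_pow_le_intMahler {f : ℤ[X]} (hf : f.Monic) (r : ℝ) :
    max 1 r ^ numRootsNorm f r ≤ intMahler f := by
  classical
  have key : ∀ s : Multiset ℂ,
      max 1 r ^ (s.filter fun z => ‖z‖ = r).card ≤ (s.map fun z => max 1 ‖z‖).prod := by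
    intro s
    induction s using Multiset.induction with
    | empty => simp
    | cons a s ih =>
      have h0 : 0 ≤ max 1 r ^ (s.filter fun z => ‖z‖ = r).card := by positivity
      rw [Multiset.map_cons, Multiset.prod_cons]
      by_cases ha : ‖a‖ = r
      · rw [Multiset.filter_cons_of_pos (p := fun z : ℂ => ‖z‖ = r) s ha, Multiset.card_cons, pow_succ', ha]
        gcongr
      · rw [Multiset.filter_cons_of_neg (p := fun z : ℂ => ‖z‖ = r) s ha]
        calc _ = 1 * max 1 r ^ (s.filter fun z => ‖z‖ = r).card := (one_mul _).symm
          _ ≤ _ := by gcongr; exact le_max_left _ _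
  rw [intMahler, mahlerMeasure_eq_leadingCoeff_mul_prod_roots, (hf.map _).leadingCoeff]
  simp only [norm_one, one_mul]
  convert key (f.aroots ℂ)
  simp only [numRootsNorm]

/-! ### Counting polynomials with several roots of maximal modulus. -/

/-- A monic polynomial of Mahler measure at most `t` whose `κ` largest roots have the same modulus
has its coefficient of index `d - j` of size at most about `t ^ rootWeight κ j`. -/
noncomputable def rootWeight (κ j : ℕ) : ℝ := min 1 ((j : ℝ) / κ)

theorem rootWeight_nonneg (κ j : ℕ) : 0 ≤ rootWeight κ j := by
  unfold rootWeight; positivity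

theorem sum_rootWeight {κ d : ℕ} (hκ : 1 ≤ κ) (hd : κ ≤ d) :
    ∑ i ∈ Finset.range d, rootWeight κ (i + 1) = d - ((κ : ℝ) - 1) / 2 := by
  have hκ0 : (0 : ℝ) < κ := by exact_mod_cast hκ
  induction d, hd using Nat.le_induction with
  | base =>
    have : ∀ i ∈ Finset.range κ, rootWeight κ (i + 1) = ((i : ℝ) + 1) / κ := by
      intro i hi
      have : (i : ℝ) + 1 ≤ κ := by exact_mod_cast Finset.mem_range.1 hi
      rw [rootWeight, min_eq_right]
      · push_cast; rfl
      · push_cast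
        rwa [div_le_one hκ0]
    rw [Finset.sum_congr rfl this, ← Finset.sum_div, Finset.sum_add_distrib]
    have h2 := Finset.sum_range_id_mul_two κ
    have h3 : (∑ i ∈ Finset.range κ, (i : ℝ)) * 2 = κ * (κ - 1) := by
      have := congrArg (Nat.cast (R := ℝ)) h2
      push_cast [Nat.cast_sub hκ] at this
      exact this
    simp only [Finset.sum_const, Finset.card_range, nsmul_eq_mul, mul_one]
    field_simp
    linarith
  | succ d hd ih =>
    rw [Finset.sum_range_succ, ih, rootWeight, min_eq_left]
    · push_cast; ring
    · rw [one_le_div hκ0]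
      exact_mod_cast hd.trans (Nat.le_succ d)

/-- The omitted weight is that of the constant coefficient, which is `1` because `κ` does not exceed
the degree. Prescribing a root modulus therefore saves exactly one power of `t`. -/
theorem sum_rootWeight_pred {κ m : ℕ} (hκ : 1 ≤ κ) (hd : κ ≤ m + 1) :
    ∑ i ∈ Finset.range m, rootWeight κ (i + 1) = m - ((κ : ℝ) - 1) / 2 := by
  have h := sum_rootWeight hκ hd
  rw [Finset.sum_range_succ] at h
  have h2 : rootWeight κ (m + 1) = 1 := by
    rw [rootWeight, min_eq_left]
    rw [one_le_div (by exact_mod_cast hκ)]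
    exact_mod_cast hd
  rw [h2] at h
  push_cast at h
  linarith

/-- The box containing the polynomials described in `rootWeight`. -/
noncomputable def rootBox (d κ : ℕ) (t : ℝ) : Finset ℤ[X] :=
  monicBox d fun i => 2 ^ d * t ^ rootWeight κ (d - i)

/-- For `j ≥ κ` the Mahler measure alone bounds the coefficient of index `d - j`. For `j < κ` that
coefficient is a sum of products of `j` roots, each at most `max 1 r ≤ t ^ (1 / κ)`. With `κ = 1`
the second case is void, so this choice also serves factors without roots on the circle. -/
theorem mem_rootBox {f : ℤ[X]} (hf : f.Monic) {r t : ℝ} (hr : ∀ z ∈ f.aroots ℂ, ‖z‖ ≤ r) {κ : ℕ}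
    (hκ : 1 ≤ κ) (h : κ = 1 ∨ κ ≤ numRootsNorm f r) (ht : intMahler f ≤ t) :
    f ∈ rootBox f.natDegree κ t := by
  have ht1 : 1 ≤ t := (one_le_intMahler hf).trans ht
  have hκ0 : (0 : ℝ) < κ := by exact_mod_cast hκ
  refine (mem_monicBox fun i _ => by positivity).2 ⟨hf, rfl, fun i hi => ?_⟩
  by_cases hj : κ ≤ f.natDegree - i
  · rw [rootWeight, min_eq_left, Real.rpow_one]
    · exact (abs_coeff_le_intMahler f i).trans (by gcongr)
    · rw [one_le_div hκ0]
      exact_mod_cast hj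
  · have hκ' : κ ≤ numRootsNorm f r := h.resolve_left (by omega)
    have hB : max 1 r ^ κ ≤ t :=
      ((pow_le_pow_right₀ (le_max_left _ _) hκ').trans (max_one_pow_le_intMahler hf r)).trans ht
    refine (abs_coeff_le_of_roots hf (B := max 1 r) (by positivity)
      (fun z hz => (hr z hz).trans (le_max_right _ _)) i).trans ?_
    gcongr
    rw [rootWeight, min_eq_right]
    · calc max 1 r ^ (f.natDegree - i)
          = (max 1 r ^ κ) ^ (((f.natDegree - i : ℕ) : ℝ) / κ) := by
            rw [← Real.rpow_natCast, ← Real.rpow_natCast, ← Real.rpow_mul (by positivity)]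
            congr 1
            field_simp
        _ ≤ _ := by gcongr
    · rw [div_le_one hκ0]
      exact_mod_cast (not_le.1 hj).le

theorem one_le_rootBox_bound (d κ j : ℕ) {t : ℝ} (ht : 1 ≤ t) :
    1 ≤ 2 ^ d * t ^ rootWeight κ j :=
  one_le_mul_of_one_le_of_one_le (one_le_pow₀ one_le_two)
    (Real.one_le_rpow ht (rootWeight_nonneg κ j))

theorem card_rootBox_le {d κ : ℕ} (hκ : 1 ≤ κ) (hd : κ ≤ d) {t : ℝ} (ht : 1 ≤ t) :
    ((rootBox d κ t).card : ℝ) ≤ (3 ^ d * (2 ^ d) ^ d) * t ^ (d - ((κ : ℝ) - 1) / 2) := by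
  refine (card_monicBox_le fun i _ => one_le_rootBox_bound d κ _ ht).trans ?_
  rw [Finset.prod_mul_distrib, ← sum_rootWeight hκ hd, ← Finset.sum_range_reflect,
    Real.rpow_sum_of_pos (by linarith), Finset.prod_const, Finset.card_range, mul_assoc]
  refine le_of_eq ?_
  congr 2
  refine Finset.prod_congr rfl fun i hi => ?_
  have := Finset.mem_range.1 hi
  congr 2
  omega

theorem card_rootBox_filter_le {m κ : ℕ} (hκ : 1 ≤ κ) (hd : κ ≤ m + 1) {t : ℝ} (ht : 1 ≤ t) (r : ℝ)
    (s : Finset ℤ[X]) (hs : ∀ f ∈ s, f ∈ rootBox (m + 1) κ t)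
    (hr : ∀ f ∈ s, ∃ z : ℂ, ‖z‖ = r ∧ aeval z f = 0) :
    (s.card : ℝ) ≤ (2 * (m + 1) * (3 ^ m * (2 ^ (m + 1)) ^ m)) * t ^ (m - ((κ : ℝ) - 1) / 2) := by
  have h1 := card_filter_root_norm_le
    (fun i _ => zero_le_one.trans (one_le_rootBox_bound (m + 1) κ _ ht)) r s hs hr
  have h2 := card_monicBox_le (m := m)
    (fun i _ => one_le_rootBox_bound (m + 1) κ (m + 1 - (i + 1)) ht)
  have h3 : ∏ i ∈ Finset.range m, (2 : ℝ) ^ (m + 1) * t ^ rootWeight κ (m + 1 - (i + 1)) =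
      (2 ^ (m + 1)) ^ m * t ^ (m - ((κ : ℝ) - 1) / 2) := by
    rw [Finset.prod_mul_distrib, ← sum_rootWeight_pred hκ hd, ← Finset.sum_range_reflect,
      Real.rpow_sum_of_pos (by linarith), Finset.prod_const, Finset.card_range]
    congr 1
    refine Finset.prod_congr rfl fun i hi => ?_
    have := Finset.mem_range.1 hi
    congr 2
    omega
  rw [h3] at h2
  have h4 : (s.card : ℝ) ≤ 2 * (m + 1) * (monicBox m fun i =>
      2 ^ (m + 1) * t ^ rootWeight κ (m + 1 - (i + 1))).card := by exact_mod_cast h1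
  refine (h4.trans (mul_le_mul_of_nonneg_left h2 (by positivity))).trans (le_of_eq ?_)
  ring

/-! ### Dyadic summation over the measures of the two factors. -/

/-- Replacing one of the exponents by `T` turns the sum into a geometric series. If `u < T`, its
last term dominates, where `2 ^ a` is about `K * H`; if `v < T`, its first term does. With `u = v =
T` a factor `log H` would appear. -/
theorem exists_sum_dyadic_le {u v T K : ℝ} (hu : u ≤ T) (hv : v ≤ T) (huv : u < T ∨ v < T)
    (hK : 1 ≤ K) : ∃ C : ℝ, 0 < C ∧ ∀ H : ℝ, 1 ≤ H → ∀ L : ℕ, (2 : ℝ) ^ L ≤ K * H →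
      ∑ a ∈ Finset.range (L + 1), ((2 : ℝ) ^ a) ^ v * (K * H / 2 ^ a) ^ u ≤ C * H ^ T := by
  have hone : ∀ H : ℝ, 1 ≤ H → ∀ L : ℕ, (2 : ℝ) ^ L ≤ K * H → ∀ a ∈ Finset.range (L + 1),
      1 ≤ K * H / 2 ^ a := by
    intro H hH L hL a ha
    rw [one_le_div (by positivity)]
    exact (pow_le_pow_right₀ one_le_two (Nat.lt_succ_iff.1 (Finset.mem_range.1 ha))).trans hL
  rcases huv with h | h
  · set q : ℝ := 2 ^ (T - u)
    have hq : 1 < q := Real.one_lt_rpow one_lt_two (by linarith)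
    refine ⟨q / (q - 1) * K ^ T, by have : 0 < q - 1 := by linarith
                                    positivity, fun H hH L hL => ?_⟩
    have hKH : 0 < K * H := by positivity
    have hterm : ∀ a ∈ Finset.range (L + 1), ((2 : ℝ) ^ a) ^ v * (K * H / 2 ^ a) ^ u ≤
        (K * H) ^ u * q ^ a := by
      intro a ha
      calc ((2 : ℝ) ^ a) ^ v * (K * H / 2 ^ a) ^ u
          ≤ ((2 : ℝ) ^ a) ^ T * (K * H / 2 ^ a) ^ u := by
            gcongr
            exact one_le_pow₀ one_le_two
        _ = (K * H) ^ u * q ^ a := by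
            rw [Real.div_rpow hKH.le (by positivity), ← Real.rpow_natCast q, ← Real.rpow_mul zero_le_two,
              mul_comm (T - u), Real.rpow_mul zero_le_two, Real.rpow_natCast, Real.rpow_sub (by positivity)]
            ring
    refine (Finset.sum_le_sum hterm).trans ?_
    rw [← Finset.mul_sum, geom_sum_eq hq.ne']
    have h1 : q ^ (L + 1) ≤ q * (K * H) ^ (T - u) := by
      rw [pow_succ', ← Real.rpow_natCast q L, ← Real.rpow_mul zero_le_two, mul_comm (T - u),
        Real.rpow_mul zero_le_two, Real.rpow_natCast]
      gcongr
    calc (K * H) ^ u * ((q ^ (L + 1) - 1) / (q - 1))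
        ≤ (K * H) ^ u * ((q * (K * H) ^ (T - u)) / (q - 1)) := by
          have : 0 < q - 1 := by linarith
          gcongr
          linarith
      _ = q / (q - 1) * K ^ T * H ^ T := by
          rw [mul_assoc, ← Real.mul_rpow (x := K) (y := H) (by linarith) (by linarith), Real.rpow_sub hKH]
          have : (K * H) ^ u ≠ 0 := (Real.rpow_pos_of_pos hKH _).ne'
          field_simp
  · set q : ℝ := 2 ^ (v - T)
    have hq0 : 0 < q := by positivity
    have hq : q < 1 := Real.rpow_lt_one_of_one_lt_of_neg one_lt_two (by linarith)
    refine ⟨1 / (1 - q) * K ^ T, by have : 0 < 1 - q := by linarith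
                                    positivity, fun H hH L hL => ?_⟩
    have hKH : 0 < K * H := by positivity
    have hterm : ∀ a ∈ Finset.range (L + 1), ((2 : ℝ) ^ a) ^ v * (K * H / 2 ^ a) ^ u ≤
        (K * H) ^ T * q ^ a := by
      intro a ha
      calc ((2 : ℝ) ^ a) ^ v * (K * H / 2 ^ a) ^ u
          ≤ ((2 : ℝ) ^ a) ^ v * (K * H / 2 ^ a) ^ T := by
            gcongr
            exact hone H hH L hL a ha
        _ = (K * H) ^ T * q ^ a := by
            rw [Real.div_rpow hKH.le (by positivity), ← Real.rpow_natCast q, ← Real.rpow_mul zero_le_two,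
              mul_comm (v - T), Real.rpow_mul zero_le_two, Real.rpow_natCast, Real.rpow_sub (by positivity)]
            ring
    refine (Finset.sum_le_sum hterm).trans ?_
    rw [← Finset.mul_sum, geom_sum_eq hq.ne, ← neg_div_neg_eq, neg_sub, neg_sub]
    calc (K * H) ^ T * ((1 - q ^ (L + 1)) / (1 - q))
        ≤ (K * H) ^ T * (1 / (1 - q)) := by
          have : 0 < 1 - q := by linarith
          gcongr
          linarith [pow_pos hq0 (L + 1)]
      _ = _ := by rw [Real.mul_rpow (by linarith) (by linarith)]; ring

/-- Counting products `g * h` by splitting the Mahler measure of `h` into dyadic intervals. -/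
theorem exists_card_products_le {u v T K C₁ C₂ : ℝ} (hu : u ≤ T) (hv : v ≤ T)
    (huv : u < T ∨ v < T) (hK : 1 ≤ K) (hC₁ : 0 < C₁) (hC₂ : 0 < C₂) (p : ℤ[X] → ℤ[X] → Prop)
    (hp : ∀ g h, p g h → g.Monic ∧ h.Monic)
    (hh : ∀ t : ℝ, 1 ≤ t → ∃ s : Finset ℤ[X], s.card ≤ C₁ * t ^ v ∧
      ∀ g h, p g h → intMahler h ≤ t → h ∈ s)
    (hg : ∀ h, ∀ t : ℝ, 1 ≤ t → ∃ s : Finset ℤ[X], s.card ≤ C₂ * t ^ u ∧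
      ∀ g, p g h → intMahler g ≤ t → g ∈ s) :
    ∃ C : ℝ, 0 < C ∧ ∀ H : ℝ, 1 ≤ H → ∀ s : Finset ℤ[X],
      (∀ f ∈ s, ∃ g h, p g h ∧ f = g * h ∧ intMahler f ≤ K * H) → s.card ≤ C * H ^ T := by
  classical
  obtain ⟨C, hC, hsum⟩ := exists_sum_dyadic_le hu hv huv hK
  -- The factor `2 ^ v` arises because `h` is counted up to measure `2 ^ (a + 1)`, the upper end of
  -- its dyadic interval.
  refine ⟨C₁ * 2 ^ v * C₂ * C, by positivity, fun H hH s hs => ?_⟩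
  have hKH : 1 ≤ K * H := one_le_mul_of_one_le_of_one_le hK hH
  choose! Sh hSh hSh' using hh
  choose! Sg hSg hSg' using hg
  set L := Nat.log 2 ⌊K * H⌋₊
  have hL : (2 : ℝ) ^ L ≤ K * H := by
    have h1 : 2 ^ L ≤ ⌊K * H⌋₊ := Nat.pow_log_le_self 2 (Nat.floor_pos.2 hKH).ne'
    calc (2 : ℝ) ^ L ≤ (⌊K * H⌋₊ : ℝ) := by exact_mod_cast h1
      _ ≤ _ := Nat.floor_le (by linarith)
  have hcov : s ⊆ (Finset.range (L + 1)).biUnion fun a =>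
      (Sh (2 ^ (a + 1))).biUnion fun h => (Sg h (K * H / 2 ^ a)).image fun g => g * h := by
    intro f hf
    obtain ⟨g, h, hgh, rfl, hM⟩ := hs f hf
    obtain ⟨hgm, hhm⟩ := hp g h hgh
    rw [intMahler_mul] at hM
    have h1 := one_le_intMahler hgm
    have h2 := one_le_intMahler hhm
    have h3 : intMahler h ≤ K * H := le_trans (le_mul_of_one_le_left (by linarith) h1) hM
    set a := Nat.log 2 ⌊intMahler h⌋₊
    have ha1 : (2 : ℝ) ^ a ≤ intMahler h := by
      have h4 : 2 ^ a ≤ ⌊intMahler h⌋₊ := Nat.pow_log_le_self 2 (Nat.floor_pos.2 h2).ne'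
      calc (2 : ℝ) ^ a ≤ (⌊intMahler h⌋₊ : ℝ) := by exact_mod_cast h4
        _ ≤ _ := Nat.floor_le (by linarith)
    have ha2 : intMahler h ≤ 2 ^ (a + 1) := by
      have h4 : ⌊intMahler h⌋₊ < 2 ^ (a + 1) := Nat.lt_pow_succ_log_self one_lt_two _
      have h5 : (⌊intMahler h⌋₊ : ℝ) + 1 ≤ 2 ^ (a + 1) := by exact_mod_cast h4
      linarith [Nat.lt_floor_add_one (intMahler h)]
    have haL : a ≤ L := Nat.log_mono_right (Nat.floor_le_floor h3)
    have hg2 : intMahler g ≤ K * H / 2 ^ a := by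
      rw [le_div_iff₀ (by positivity)]
      exact le_trans (by gcongr) hM
    simp only [Finset.mem_biUnion, Finset.mem_image]
    exact ⟨a, Finset.mem_range.2 (by omega), h,
      hSh' _ (one_le_pow₀ one_le_two) g h hgh ha2, g, hSg' h _ (h1.trans hg2) g hgh hg2, rfl⟩
  have hcard : ∀ a ∈ Finset.range (L + 1),
      (((Sh (2 ^ (a + 1))).biUnion fun h => (Sg h (K * H / 2 ^ a)).image fun g => g * h).card : ℝ) ≤
        C₁ * 2 ^ v * C₂ * (((2 : ℝ) ^ a) ^ v * (K * H / 2 ^ a) ^ u) := by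
    intro a ha
    have h1 : 1 ≤ K * H / 2 ^ a := by
      rw [one_le_div (by positivity)]
      exact (pow_le_pow_right₀ one_le_two (Nat.lt_succ_iff.1 (Finset.mem_range.1 ha))).trans hL
    calc _ ≤ (∑ h ∈ Sh (2 ^ (a + 1)), ((Sg h (K * H / 2 ^ a)).card : ℝ)) := by
          exact_mod_cast Finset.card_biUnion_le.trans
            (Finset.sum_le_sum fun h _ => Finset.card_image_le)
      _ ≤ ∑ h ∈ Sh (2 ^ (a + 1)), C₂ * (K * H / 2 ^ a) ^ u :=
          Finset.sum_le_sum fun h _ => hSg h _ h1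
      _ = (Sh (2 ^ (a + 1))).card * (C₂ * (K * H / 2 ^ a) ^ u) := by simp
      _ ≤ C₁ * ((2 : ℝ) ^ (a + 1)) ^ v * (C₂ * (K * H / 2 ^ a) ^ u) := by
          gcongr
          exact hSh _ (one_le_pow₀ one_le_two)
      _ = _ := by
          rw [pow_succ, Real.mul_rpow (by positivity) zero_le_two]
          ring
  calc (s.card : ℝ) ≤ _ := Nat.cast_le.2 (Finset.card_le_card hcov)
    _ ≤ ∑ a ∈ Finset.range (L + 1), (((Sh (2 ^ (a + 1))).biUnion fun h =>
          (Sg h (K * H / 2 ^ a)).image fun g => g * h).card : ℝ) := by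
        exact_mod_cast Finset.card_biUnion_le
    _ ≤ _ := Finset.sum_le_sum hcard
    _ ≤ C₁ * 2 ^ v * C₂ * (C * H ^ T) := by
        rw [← Finset.mul_sum]
        gcongr
        exact hsum H hH L hL
    _ = _ := by ring

/-! ### Factorizations and the upper bound. -/

theorem numDominantRoots_eq {f : ℤ[X]} {r : ℝ} (hr : ∀ z ∈ f.aroots ℂ, ‖z‖ ≤ r)
    (h : ∃ z ∈ f.aroots ℂ, ‖z‖ = r) : numDominantRoots f = numRootsNorm f r := by
  classical
  obtain ⟨z₀, hz₀, rfl⟩ := h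
  rw [numDominantRoots, numRootsNorm]
  congr 1
  refine Multiset.filter_congr fun z hz => ⟨fun h => le_antisymm (hr z hz) (h z₀ hz₀), ?_⟩
  intro h w hw
  rw [h]
  exact hr w hw

theorem exists_norm_of_numDominantRoots_pos {f : ℤ[X]} (hf : 0 < numDominantRoots f) :
    ∃ r : ℝ, (∀ z ∈ f.aroots ℂ, ‖z‖ ≤ r) ∧ numRootsNorm f r = numDominantRoots f := by
  classical
  rw [numDominantRoots, Multiset.card_pos_iff_exists_mem] at hf
  obtain ⟨z, hz⟩ := hf
  obtain ⟨hz1, hz2⟩ := Multiset.mem_filter.1 hz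
  exact ⟨‖z‖, hz2, (numDominantRoots_eq hz2 ⟨z, hz1, rfl⟩).symm⟩

theorem numRootsNorm_mul {f g : ℤ[X]} (h : f * g ≠ 0) (r : ℝ) :
    numRootsNorm (f * g) r = numRootsNorm f r + numRootsNorm g r := by
  rw [numRootsNorm, aroots_mul h, Multiset.filter_add, Multiset.card_add]
  rfl

theorem numRootsNorm_le {f : ℤ[X]} (hf : f.Monic) (r : ℝ) : numRootsNorm f r ≤ f.natDegree := by
  classical
  rw [numRootsNorm]
  refine (Multiset.card_le_card (Multiset.filter_le _ _)).trans ((card_roots' _).trans ?_)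
  exact (hf.natDegree_map _).le

theorem exists_root_of_numRootsNorm_pos {f : ℤ[X]} {r : ℝ} (h : 0 < numRootsNorm f r) :
    ∃ z ∈ f.aroots ℂ, ‖z‖ = r := by
  classical
  rw [numRootsNorm, Multiset.card_pos_iff_exists_mem] at h
  obtain ⟨z, hz⟩ := h
  exact ⟨z, Multiset.mem_filter.1 hz⟩

/-- `g` and `h` are monic of degrees `m` and `d`, and have respectively `k₁` and `k₂` roots on a
circle around `0` that encloses all roots of `g * h`. -/
def FactorPair (m d k₁ k₂ : ℕ) (g h : ℤ[X]) : Prop :=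
  (g.Monic ∧ g.natDegree = m) ∧ (h.Monic ∧ h.natDegree = d) ∧ ∃ r : ℝ,
    ((∀ z ∈ g.aroots ℂ, ‖z‖ ≤ r) ∧ numRootsNorm g r = k₁) ∧
    ((∀ z ∈ h.aroots ℂ, ‖z‖ ≤ r) ∧ numRootsNorm h r = k₂)

theorem FactorPair.right_mem_rootBox {m d k₁ k₂ : ℕ} (hk : 1 ≤ k₂) {g h : ℤ[X]}
    (H : FactorPair m d k₁ k₂ g h) {t : ℝ} (ht : intMahler h ≤ t) : h ∈ rootBox d k₂ t := by
  obtain ⟨-, ⟨hh, rfl⟩, r, -, hr, hk₂⟩ := H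
  exact mem_rootBox hh hr hk (Or.inr hk₂.ge) ht

/-- The counting exponents are `u = m` and `v = d - (k - 1) / 2`. Both would equal the target only
if `m = d = k = 1`, which `hn` excludes; this is the source of the logarithm in degree `2`. -/
theorem exists_card_products_le_of_left_zero {m d k : ℕ} (hm : 1 ≤ m) (hk : 1 ≤ k) (hkd : k ≤ d)
    (hn : 3 ≤ m + d) {K : ℝ} (hK : 1 ≤ K) :
    ∃ C : ℝ, 0 < C ∧ ∀ H : ℝ, 1 ≤ H → ∀ s : Finset ℤ[X],
      (∀ f ∈ s, ∃ g h, FactorPair m d 0 k g h ∧ f = g * h ∧ intMahler f ≤ K * H) →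
        s.card ≤ C * H ^ (((m + d : ℕ) : ℝ) - ((k : ℝ) + 1) / 2) := by
  have hm' : (1 : ℝ) ≤ m := by exact_mod_cast hm
  have hk' : (1 : ℝ) ≤ k := by exact_mod_cast hk
  have hkd' : (k : ℝ) ≤ d := by exact_mod_cast hkd
  have hn' : (3 : ℝ) ≤ m + d := by exact_mod_cast hn
  refine exists_card_products_le (u := m - (((1 : ℕ) : ℝ) - 1) / 2) (v := d - ((k : ℝ) - 1) / 2)
    (C₁ := 3 ^ d * (2 ^ d) ^ d) (C₂ := 3 ^ m * (2 ^ m) ^ m) ?_ ?_ ?_ hK (by positivity)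
    (by positivity) (FactorPair m d 0 k) (fun g h H => ⟨H.1.1, H.2.1.1⟩) ?_ ?_
  · push_cast; linarith
  · push_cast; linarith
  · push_cast
    by_contra! h
    linarith [h.1, h.2]
  · intro t ht
    exact ⟨rootBox d k t, card_rootBox_le hk hkd ht, fun g h H hM => H.right_mem_rootBox hk hM⟩
  · intro h t ht
    refine ⟨rootBox m 1 t, card_rootBox_le le_rfl hm ht, fun g H hM => ?_⟩
    obtain ⟨⟨hg, rfl⟩, -, r, ⟨hr, -⟩, -⟩ := H
    exact mem_rootBox hg hr le_rfl (Or.inl rfl) hM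

/-- Since `h` fixes the modulus of the dominant roots of `g`, the exponent for `g` drops by one. The
target exceeds `u` by `d - k₂ / 2 > 0` and `v` by `m - k₁ / 2`. The latter is nonnegative because
the first factor has degree `m + 1 ≥ 2`. -/
theorem exists_card_products_le_of_both_pos {m d k₁ k₂ : ℕ} (hm : 1 ≤ m) (hk₁ : 1 ≤ k₁)
    (hk₂ : 1 ≤ k₂) (hkm : k₁ ≤ m + 1) (hkd : k₂ ≤ d) {K : ℝ} (hK : 1 ≤ K) :
    ∃ C : ℝ, 0 < C ∧ ∀ H : ℝ, 1 ≤ H → ∀ s : Finset ℤ[X],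
      (∀ f ∈ s, ∃ g h, FactorPair (m + 1) d k₁ k₂ g h ∧ f = g * h ∧ intMahler f ≤ K * H) →
        s.card ≤ C * H ^ (((m + 1 + d : ℕ) : ℝ) - (((k₁ + k₂ : ℕ) : ℝ) + 1) / 2) := by
  classical
  have hm' : (1 : ℝ) ≤ m := by exact_mod_cast hm
  have hk' : (1 : ℝ) ≤ k₂ := by exact_mod_cast hk₂
  have hkm' : (k₁ : ℝ) ≤ m + 1 := by exact_mod_cast hkm
  have hkd' : (k₂ : ℝ) ≤ d := by exact_mod_cast hkd
  refine exists_card_products_le (u := m - ((k₁ : ℝ) - 1) / 2) (v := d - ((k₂ : ℝ) - 1) / 2)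
    (C₁ := 3 ^ d * (2 ^ d) ^ d) (C₂ := 2 * (m + 1) * (3 ^ m * (2 ^ (m + 1)) ^ m)) ?_ ?_ ?_ hK
    (by positivity) (by positivity) (FactorPair (m + 1) d k₁ k₂)
    (fun g h H => ⟨H.1.1, H.2.1.1⟩) ?_ ?_
  · push_cast; linarith
  · push_cast; linarith
  · push_cast; left; linarith
  · intro t ht
    exact ⟨rootBox d k₂ t, card_rootBox_le hk₂ hkd ht, fun g h H hM => H.right_mem_rootBox hk₂ hM⟩
  · intro h t ht
    by_cases hex : ∃ r : ℝ, (∀ z ∈ h.aroots ℂ, ‖z‖ ≤ r) ∧ numRootsNorm h r = k₂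
    · obtain ⟨r, hr, hrk⟩ := hex
      refine ⟨{g ∈ rootBox (m + 1) k₁ t | ∃ z : ℂ, ‖z‖ = r ∧ aeval z g = 0},
        card_rootBox_filter_le hk₁ hkm ht r _ (fun f hf => (Finset.mem_filter.1 hf).1)
          (fun f hf => (Finset.mem_filter.1 hf).2), fun g H hM => ?_⟩
      obtain ⟨⟨hg, hgd⟩, -, r', ⟨hgr, hgk⟩, hhr, hhk⟩ := H
      -- As `k₂ ≥ 1`, both radii are the largest modulus of a root of `h`.
      have hrr : r = r' := by
        obtain ⟨z, hz, rfl⟩ := exists_root_of_numRootsNorm_pos (f := h) (r := r) (by omega)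
        obtain ⟨w, hw, rfl⟩ := exists_root_of_numRootsNorm_pos (f := h) (r := r') (by omega)
        exact le_antisymm (hhr z hz) (hr w hw)
      subst hrr
      refine Finset.mem_filter.2 ⟨hgd ▸ mem_rootBox hg hgr hk₁ (Or.inr hgk.ge) hM, ?_⟩
      obtain ⟨z, hz, hzr⟩ := exists_root_of_numRootsNorm_pos (f := g) (r := r) (by omega)
      exact ⟨z, hzr, (mem_aroots.1 hz).2⟩
    · refine ⟨∅, by rw [Finset.card_empty, Nat.cast_zero]; positivity, fun g H _ => (hex ?_).elim⟩
      obtain ⟨-, -, r, -, hr⟩ := H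
      exact ⟨r, hr⟩

/-- The degree `m` and number `k₁` of dominant roots of the first factor to which every
factorization can be brought by exchanging the factors. -/
def NormalizedSplit (n k m k₁ : ℕ) : Prop :=
  1 ≤ m ∧ m < n ∧ k - k₁ ≤ n - m ∧
    (k₁ = 0 ∨ 2 ≤ m ∧ 1 ≤ k₁ ∧ k₁ ≤ m ∧ 1 ≤ k - k₁)

theorem exists_card_products_le_of_split {n k m k₁ : ℕ} (hn : 3 ≤ n) (hk : 1 ≤ k)
    (hs : NormalizedSplit n k m k₁) {K : ℝ} (hK : 1 ≤ K) :
    ∃ C : ℝ, 0 < C ∧ ∀ H : ℝ, 1 ≤ H → ∀ s : Finset ℤ[X],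
      (∀ f ∈ s, ∃ g h, FactorPair m (n - m) k₁ (k - k₁) g h ∧ f = g * h ∧ intMahler f ≤ K * H) →
        s.card ≤ C * H ^ ((n : ℝ) - ((k : ℝ) + 1) / 2) := by
  obtain ⟨h1, h2, h3, h4⟩ := hs
  rcases h4 with rfl | ⟨h4, h5, h6, h7⟩
  · have := exists_card_products_le_of_left_zero h1 hk h3 (by omega) hK
    rwa [show m + (n - m) = n by omega] at this
  · obtain ⟨m, rfl⟩ : ∃ m', m = m' + 1 := ⟨m - 1, by omega⟩
    have := exists_card_products_le_of_both_pos (m := m) (by omega) h5 h7 h6 h3 hK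
    rwa [show m + 1 + (n - (m + 1)) = n by omega, show k₁ + (k - k₁) = k by omega] at this

theorem exists_normalizedSplit {n k H : ℕ} (hn : 3 ≤ n) (hk : 1 ≤ k) {f : ℤ[X]}
    (hf : f ∈ dominantPolys n k H) (hirr : ¬ Irreducible f) :
    ∃ m < n, ∃ k₁ < k + 1, NormalizedSplit n k m k₁ ∧
      ∃ g h, FactorPair m (n - m) k₁ (k - k₁) g h ∧ f = g * h := by
  obtain ⟨hm, hd, -, hdom⟩ := hf
  have h1 : f ≠ 1 := by
    rintro rfl
    rw [natDegree_one] at hd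
    omega
  rw [hm.irreducible_iff_natDegree'] at hirr
  push Not at hirr
  obtain ⟨a, b, ha, hb, rfl, hab⟩ := hirr h1
  obtain ⟨hab1, hab2⟩ := Finset.mem_Ioc.1 hab
  have hdeg := ha.natDegree_mul hb
  obtain ⟨r, hr, hrk⟩ := exists_norm_of_numDominantRoots_pos (f := a * b) (by omega)
  rw [numRootsNorm_mul hm.ne_zero, hdom] at hrk
  rw [aroots_mul hm.ne_zero] at hr
  have hra : ∀ z ∈ a.aroots ℂ, ‖z‖ ≤ r := fun z hz => hr z (Multiset.mem_add.2 (Or.inl hz))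
  have hrb : ∀ z ∈ b.aroots ℂ, ‖z‖ ≤ r := fun z hz => hr z (Multiset.mem_add.2 (Or.inr hz))
  have hla := numRootsNorm_le ha r
  have hlb := numRootsNorm_le hb r
  have key : ∀ g h : ℤ[X], g.Monic → h.Monic → (∀ z ∈ g.aroots ℂ, ‖z‖ ≤ r) →
      (∀ z ∈ h.aroots ℂ, ‖z‖ ≤ r) → g.natDegree + h.natDegree = n →
      numRootsNorm g r + numRootsNorm h r = k →
      NormalizedSplit n k g.natDegree (numRootsNorm g r) → g * h = a * b →
      ∃ m < n, ∃ k₁ < k + 1, NormalizedSplit n k m k₁ ∧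
      ∃ g h, FactorPair m (n - m) k₁ (k - k₁) g h ∧ a * b = g * h := by
    intro g h hg hh hgr hhr hn hk hs he
    exact ⟨_, hs.2.1, _, by omega, hs, g, h,
      ⟨⟨hg, rfl⟩, ⟨hh, by omega⟩, r, ⟨hgr, rfl⟩, hhr, by omega⟩, he.symm⟩
  -- The first factor is to be one without roots on the circle, if there is one. Otherwise it is to
  -- have degree at least `2`, which is possible because `n ≥ 3`.
  by_cases hswap : numRootsNorm b r = 0 ∨ (numRootsNorm a r ≠ 0 ∧ 2 ≤ b.natDegree)
  · refine key b a hb ha hrb hra (by omega) (by omega) ?_ (mul_comm _ _)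
    unfold NormalizedSplit
    omega
  · refine key a b ha hb hra hrb (by omega) (by omega) ?_ rfl
    unfold NormalizedSplit
    omega

theorem reducibleCount_le {n k : ℕ} (hn : 3 ≤ n) (hk : 1 ≤ k) :
    ∃ C : ℝ, 0 < C ∧ ∀ H : ℕ, 1 ≤ H →
      (reducibleCount n k H : ℝ) ≤ C * (H : ℝ) ^ ((n : ℝ) - ((k : ℝ) + 1) / 2) := by
  classical
  -- `K = n + 1` comes from bounding the measure by the sum of the `n + 1` absolute values of the
  -- coefficients.
  have hK : (1 : ℝ) ≤ n + 1 := by linarith [(Nat.cast_nonneg n : (0 : ℝ) ≤ n)]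
  have hpiece : ∀ m k₁ : ℕ, ∃ C : ℝ, 0 < C ∧ (NormalizedSplit n k m k₁ →
      ∀ H : ℝ, 1 ≤ H → ∀ s : Finset ℤ[X],
      (∀ f ∈ s, ∃ g h, FactorPair m (n - m) k₁ (k - k₁) g h ∧ f = g * h ∧
        intMahler f ≤ (n + 1) * H) → s.card ≤ C * H ^ ((n : ℝ) - ((k : ℝ) + 1) / 2)) := by
    intro m k₁
    by_cases hs : NormalizedSplit n k m k₁
    · obtain ⟨C, hC, h⟩ := exists_card_products_le_of_split hn hk hs hK
      exact ⟨C, hC, fun _ => h⟩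
    · exact ⟨1, one_pos, fun h => absurd h hs⟩
  choose C hC hbound using hpiece
  set I := Finset.range n ×ˢ Finset.range (k + 1)
  refine ⟨∑ x ∈ I, C x.1 x.2, Finset.sum_pos (fun x _ => hC _ _)
    ⟨(0, 0), by simp [I]; omega⟩, fun H hH => ?_⟩
  have hfin : {f ∈ dominantPolys n k H | ¬ Irreducible f}.Finite :=
    (dominantPolys_finite n k H).subset (Set.sep_subset _ _)
  set S := hfin.toFinset
  let piece : ℕ × ℕ → Finset ℤ[X] := fun x => {f ∈ S | NormalizedSplit n k x.1 x.2 ∧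
    ∃ g h, FactorPair x.1 (n - x.1) x.2 (k - x.2) g h ∧ f = g * h}
  have hcov : S ⊆ I.biUnion piece := by
    intro f hf
    obtain ⟨h1, h2⟩ := hfin.mem_toFinset.1 hf
    obtain ⟨m, hm, k₁, hk₁, hs, h3⟩ := exists_normalizedSplit hn hk h1 h2
    exact Finset.mem_biUnion.2 ⟨(m, k₁), by simp only [I, Finset.mem_product, Finset.mem_range]; omega,
      Finset.mem_filter.2 ⟨hf, hs, h3⟩⟩
  have hcard : ∀ x ∈ I, ((piece x).card : ℝ) ≤
      C x.1 x.2 * (H : ℝ) ^ ((n : ℝ) - ((k : ℝ) + 1) / 2) := by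
    intro x _
    have hpos := hC x.1 x.2
    by_cases hs : NormalizedSplit n k x.1 x.2
    · refine hbound _ _ hs H (by exact_mod_cast hH) _ fun f hf => ?_
      obtain ⟨hf, -, g, h, hgh, rfl⟩ := Finset.mem_filter.1 hf
      obtain ⟨⟨-, h2, h3, -⟩, -⟩ := hfin.mem_toFinset.1 hf
      refine ⟨g, h, hgh, rfl, ?_⟩
      have := intMahler_le h3
      rwa [h2] at this
    · have : piece x = ∅ := Finset.filter_eq_empty_iff.2 fun f _ h => hs h.1
      rw [this, Finset.card_empty, Nat.cast_zero]
      positivity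
  calc (reducibleCount n k H : ℝ) = S.card := by
        rw [reducibleCount, Set.ncard_eq_toFinset_card _ hfin]
    _ ≤ ∑ x ∈ I, ((piece x).card : ℝ) := by
        exact_mod_cast (Finset.card_le_card hcov).trans Finset.card_biUnion_le
    _ ≤ _ := by
        rw [Finset.sum_mul]
        exact Finset.sum_le_sum hcard

/-! ### Polynomials with all roots in a disk. -/

/-- Monic integer polynomials of degree `q` with all roots in the open disk of radius `r`. -/
noncomputable def diskBox (q : ℕ) (r : ℝ) : Finset ℤ[X] :=
  monicBox q fun i => r ^ (q - i) / (q + 1)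

theorem mem_diskBox {q : ℕ} {r : ℝ} (hr : 0 < r) {A : ℤ[X]} :
    A ∈ diskBox q r ↔ A.Monic ∧ A.natDegree = q ∧
      ∀ i < q, |(A.coeff i : ℝ)| ≤ r ^ (q - i) / (q + 1) :=
  mem_monicBox fun _ _ => by positivity

theorem norm_lt_of_mem_diskBox {q : ℕ} {r : ℝ} (hr : 0 < r) {A : ℤ[X]} (hA : A ∈ diskBox q r)
    {z : ℂ} (hz : z ∈ A.aroots ℂ) : ‖z‖ < r := by
  obtain ⟨hm, hd, hc⟩ := (mem_diskBox hr).1 hA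
  by_contra! h
  have hz0 : 0 < ‖z‖ := hr.trans_le h
  have h0 : aeval z A = 0 := (mem_aroots.1 hz).2
  rw [hm.as_sum, hd] at h0
  simp only [map_add, map_pow, aeval_X, map_sum, map_mul, aeval_C] at h0
  -- Outside the disk each of the `q` lower terms has modulus at most `‖z‖ ^ q / (q + 1)`, so
  -- together they cannot cancel the leading term.
  have h1 : ‖z‖ ^ q ≤ ∑ i ∈ Finset.range q, ‖z‖ ^ q / (q + 1) := by
    have h2 := congrArg norm (eq_neg_of_add_eq_zero_left h0)
    rw [norm_neg, norm_pow] at h2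
    refine h2.le.trans ((norm_sum_le _ _).trans (Finset.sum_le_sum fun i hi => ?_))
    have hi := Finset.mem_range.1 hi
    rw [norm_mul, norm_pow]
    calc ‖(algebraMap ℤ ℂ) (A.coeff i)‖ * ‖z‖ ^ i ≤ (r ^ (q - i) / (q + 1)) * ‖z‖ ^ i := by
          gcongr
          simpa using hc i hi
      _ ≤ (‖z‖ ^ (q - i) / (q + 1)) * ‖z‖ ^ i := by gcongr
      _ = _ := by rw [div_mul_eq_mul_div, ← pow_add, Nat.sub_add_cancel hi.le]
  rw [Finset.sum_const, Finset.card_range, nsmul_eq_mul, ← mul_div_assoc,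
    le_div_iff₀ (by positivity)] at h1
  have h2 : 0 < ‖z‖ ^ q := by positivity
  linarith

/-- The triangular number `1 + ⋯ + q`. -/
def tri (q : ℕ) : ℕ := ∑ i ∈ Finset.range q, (i + 1)

theorem cast_tri (q : ℕ) : (tri q : ℝ) = q * (q + 1) / 2 := by
  induction q with
  | zero => simp [tri]
  | succ q ih =>
    rw [tri, Finset.sum_range_succ, ← tri]
    push_cast
    rw [ih]
    ring

theorem card_diskBox_ge (q : ℕ) {r : ℝ} (hr : 0 < r) :
    ((1 / (q + 1 : ℝ)) ^ q) * r ^ tri q ≤ (diskBox q r).card := by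
  refine le_trans (le_of_eq ?_) (prod_le_card_monicBox fun _ _ => by positivity)
  rw [← Finset.prod_range_reflect, tri, ← Finset.prod_pow_eq_pow_sum]
  have : (1 / (q + 1 : ℝ)) ^ q = ∏ i ∈ Finset.range q, (1 / (q + 1 : ℝ)) := by simp
  rw [this, ← Finset.prod_mul_distrib]
  refine Finset.prod_congr rfl fun i hi => ?_
  have := Finset.mem_range.1 hi
  rw [show q - (q - 1 - i) = i + 1 by omega]
  ring

/-! ### Polynomials with all roots on a circle. -/

/-- With `s = r ^ 2 / ‖z‖ ^ 2 < 1`, the difference of the squared distances is `(1 - s) * (‖z‖ ^ 2 +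
r ^ 2 - 2 * Re (z * conj a))`. It is positive because `‖z‖ ^ 2 + r ^ 2 ≥ 2 * r * ‖z‖ > 2 * ‖a‖ *
‖z‖`. -/
theorem norm_reflect_sub_lt {z a : ℂ} {r : ℝ} (ha : ‖a‖ < r) (hz : r < ‖z‖) :
    ‖((r ^ 2 / ‖z‖ ^ 2 : ℝ) : ℂ) * z - a‖ < ‖z - a‖ := by
  have ha0 := norm_nonneg a
  have hz0 : 0 < ‖z‖ := by linarith
  set s : ℝ := r ^ 2 / ‖z‖ ^ 2
  have hs : s < 1 := by
    rw [div_lt_one (by positivity)]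
    gcongr
    linarith
  have hs2 : s * ‖z‖ ^ 2 = r ^ 2 := by simp only [s]; field_simp
  refine lt_of_pow_lt_pow_left₀ 2 (norm_nonneg _) ?_
  have h1 : (z.re * a.re + z.im * a.im) ≤ ‖z‖ * ‖a‖ := by
    have := abs_le.1 (Complex.abs_re_le_norm (z * (starRingEnd ℂ) a))
    rw [norm_mul, Complex.norm_conj] at this
    simp at this
    linarith [this.2]
  have h2 : ‖z‖ ^ 2 = z.re ^ 2 + z.im ^ 2 := by rw [Complex.sq_norm, Complex.normSq_apply]; ring
  rw [Complex.sq_norm, Complex.sq_norm, Complex.normSq_apply, Complex.normSq_apply]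
  simp only [Complex.sub_re, Complex.sub_im, Complex.re_ofReal_mul, Complex.im_ofReal_mul]
  have h3 : 0 < (1 - s) * (‖z‖ ^ 2 + s * ‖z‖ ^ 2 - 2 * (z.re * a.re + z.im * a.im)) := by
    refine mul_pos (by linarith) ?_
    rw [hs2]
    nlinarith [mul_pos hz0 (sub_pos.2 ha), sq_nonneg (‖z‖ - r)]
  rw [h2] at h3
  nlinarith

theorem Multiset.prod_map_lt_prod_map_of_pos {α : Type*} {s : Multiset α} (hs : s ≠ 0) {f g : α → ℝ}
    (hf : ∀ a ∈ s, 0 ≤ f a) (hfg : ∀ a ∈ s, f a < g a) : (s.map f).prod < (s.map g).prod := by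
  induction s using Multiset.induction with
  | empty => exact absurd rfl hs
  | cons a s ih =>
    rw [Multiset.map_cons, Multiset.map_cons, Multiset.prod_cons, Multiset.prod_cons]
    have h1 := hf a (Multiset.mem_cons_self a s)
    have h2 := hfg a (Multiset.mem_cons_self a s)
    by_cases h : s = 0
    · simpa [h] using h2
    · have h3 := ih h (fun b hb => hf b (Multiset.mem_cons_of_mem hb))
        (fun b hb => hfg b (Multiset.mem_cons_of_mem hb))
      have h4 : 0 ≤ (s.map f).prod := by
        refine Multiset.prod_nonneg fun x hx => ?_
        obtain ⟨b, hb, rfl⟩ := Multiset.mem_map.1 hx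
        exact hf b (Multiset.mem_cons_of_mem hb)
      exact mul_lt_mul'' h2 h3 h1 h4

theorem norm_aeval_eq_prod {A : ℤ[X]} (hA : A.Monic) (z : ℂ) :
    ‖aeval z A‖ = ((A.aroots ℂ).map fun a => ‖z - a‖).prod := by
  have h := (IsAlgClosed.splits (A.map (algebraMap ℤ ℂ))).eq_prod_roots_of_monic (hA.map _)
  rw [← eval_map_algebraMap, h, eval_multiset_prod, Multiset.map_map]
  simp only [Function.comp_def, eval_sub, eval_X, eval_C]
  refine (map_multiset_prod (normHom : ℂ →*₀ ℝ) _).trans ?_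
  rw [Multiset.map_map]
  rfl

theorem aeval_conj_int (A : ℤ[X]) (z : ℂ) :
    aeval ((starRingEnd ℂ) z) A = (starRingEnd ℂ) (aeval z A) := by
  simp only [aeval_def, hom_eval₂]
  congr 1
  ext; simp

/-- The point `w` is the conjugate of the reflection of `z` in the circle, and conjugation does not
change `|A|` for integer `A`. The reflection is closer than `z` to each root, so the product of
distances decreases. -/
theorem norm_aeval_lt_of_mul_eq {A : ℤ[X]} (hA : A.Monic) (hd : A.natDegree ≠ 0) {r : ℝ}
    (hroots : ∀ a ∈ A.aroots ℂ, ‖a‖ < r) {z w : ℂ} (hzw : z * w = (r : ℂ) ^ 2) (hz : r < ‖z‖) :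
    ‖aeval w A‖ < ‖aeval z A‖ := by
  have hcard : (A.aroots ℂ).card = A.natDegree := by
    rw [aroots, splits_iff_card_roots.1 (IsAlgClosed.splits _), hA.natDegree_map]
  have hne : A.aroots ℂ ≠ 0 := by
    rw [← Multiset.card_pos, hcard]; omega
  obtain ⟨a, ha⟩ := Multiset.exists_mem_of_ne_zero hne
  have hr : 0 < r := (norm_nonneg a).trans_lt (hroots a ha)
  have hz0 : z ≠ 0 := norm_pos_iff.1 (hr.trans hz)
  have hw : w = (starRingEnd ℂ) (((r ^ 2 / ‖z‖ ^ 2 : ℝ) : ℂ) * z) := by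
    have h1 : z * (starRingEnd ℂ) z = (‖z‖ : ℂ) ^ 2 := Complex.mul_conj' z
    have h2 : (‖z‖ : ℂ) ≠ 0 := by simpa using hz0
    apply mul_left_cancel₀ hz0
    rw [hzw, map_mul, Complex.conj_ofReal, mul_left_comm, h1]
    push_cast
    field_simp
  rw [hw, aeval_conj_int, Complex.norm_conj, norm_aeval_eq_prod hA, norm_aeval_eq_prod hA]
  exact Multiset.prod_map_lt_prod_map_of_pos hne (fun _ _ => norm_nonneg _)
    fun a ha => norm_reflect_sub_lt (hroots a ha) hz

/-- The polynomial `X ^ l * (A X + A (R / X))`. -/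
noncomputable def selfRecip (R : ℤ) (l : ℕ) (A : ℤ[X]) : ℤ[X] := X ^ l * A + invRev R l A

section selfRecip

variable {R : ℤ} {l : ℕ} {A : ℤ[X]}

theorem natDegree_X_pow_mul_of_monic (hA : A.Monic) (hd : A.natDegree = l) :
    (X ^ l * A).natDegree = 2 * l := by
  rw [(monic_X_pow l).natDegree_mul hA, natDegree_X_pow, hd]; ring

theorem natDegree_invRev_lt (hl : 1 ≤ l) (hA : A.Monic) (hd : A.natDegree = l) :
    (invRev R l A).natDegree < (X ^ l * A).natDegree := by
  rw [natDegree_X_pow_mul_of_monic hA hd]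
  exact (natDegree_invRev_le _ _ _).trans_lt (by omega)

theorem monic_selfRecip (hl : 1 ≤ l) (hA : A.Monic) (hd : A.natDegree = l) :
    (selfRecip R l A).Monic :=
  ((monic_X_pow l).mul hA).add_of_left (degree_lt_degree (natDegree_invRev_lt hl hA hd))

theorem natDegree_selfRecip (hl : 1 ≤ l) (hA : A.Monic) (hd : A.natDegree = l) :
    (selfRecip R l A).natDegree = 2 * l := by
  rw [selfRecip, natDegree_add_eq_left_of_natDegree_lt (natDegree_invRev_lt hl hA hd),
    natDegree_X_pow_mul_of_monic hA hd]

theorem coeff_selfRecip (i : ℕ) :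
    (selfRecip R l A).coeff (i + l) = if i = 0 then 2 * A.coeff 0 else A.coeff i := by
  rw [selfRecip, coeff_add, coeff_X_pow_mul]
  split_ifs with h
  · subst h
    rw [zero_add, coeff_invRev_self]; ring
  · rw [coeff_eq_zero_of_natDegree_lt ((natDegree_invRev_le _ _ _).trans_lt (by omega)), add_zero]

/-- The coefficients from index `l` upwards reveal `A`; only the central one is altered, by
doubling. -/
theorem selfRecip_injective (R : ℤ) (l : ℕ) : Function.Injective (selfRecip R l) := by
  intro A B h
  ext i
  have h1 := congrArg (fun f => coeff f (i + l)) h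
  simp only [coeff_selfRecip] at h1
  split_ifs at h1 with h2
  · subst h2; linarith
  · exact h1

theorem aeval_selfRecip {z w : ℂ} (h : z * w = R) (hd : A.natDegree = l) :
    aeval z (selfRecip R l A) = z ^ l * (aeval z A + aeval w A) := by
  rw [selfRecip, map_add, map_mul, map_pow, aeval_X, ← eval_map_algebraMap (invRev R l A), map_invRev,
    eval_invRev (w := w) (by simpa using h) (natDegree_map_le.trans hd.le), eval_map_algebraMap]
  ring

/-- A root `z` is nonzero, the constant coefficient being `R ^ l`, and satisfies `A(z) = -A(R / z)`.
Equal absolute values at `z` and `R / z` rule out both the inside and the outside of the circle. -/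
theorem norm_root_selfRecip (hl : 1 ≤ l) {r : ℝ} (hr : 0 < r) (hR : r ^ 2 = R) (hA : A.Monic)
    (hd : A.natDegree = l) (hroots : ∀ a ∈ A.aroots ℂ, ‖a‖ < r) {z : ℂ}
    (hz : z ∈ (selfRecip R l A).aroots ℂ) : ‖z‖ = r := by
  have hRC : (r : ℂ) ^ 2 = R := by exact_mod_cast congrArg (Complex.ofReal) hR
  have hr0 : (r : ℂ) ^ 2 ≠ 0 := by
    have : (r : ℂ) ≠ 0 := by exact_mod_cast hr.ne'
    positivity
  have h0 : aeval z (selfRecip R l A) = 0 := (mem_aroots.1 hz).2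
  have hz0 : z ≠ 0 := by
    rintro rfl
    have h1 : (selfRecip R l A).coeff 0 = R ^ l := by
      rw [selfRecip, coeff_add, mul_coeff_zero, coeff_X_pow, if_neg (by omega), zero_mul, zero_add,
        invRev, finsetSum_coeff, Finset.sum_eq_single l]
      · rw [Nat.sub_self, pow_zero, mul_one, coeff_C_zero, ← hd, hA.coeff_natDegree, one_mul]
      · intro i hi hne
        have := Finset.mem_range.1 hi
        rw [coeff_C_mul_X_pow, if_neg (by omega)]
      · simp
    rw [← coeff_zero_eq_aeval_zero', h1] at h0
    have : (R : ℂ) ^ l ≠ 0 := pow_ne_zero _ (hRC ▸ hr0)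
    exact this (by simpa using h0)
  have hmul : z * ((r : ℂ) ^ 2 / z) = (r : ℂ) ^ 2 := by field_simp
  rw [aeval_selfRecip (hmul.trans hRC) hd] at h0
  have h1 := eq_neg_of_add_eq_zero_left ((mul_eq_zero.1 h0).resolve_left (pow_ne_zero _ hz0))
  have h2 : ‖aeval z A‖ = ‖aeval ((r : ℂ) ^ 2 / z) A‖ := by rw [h1, norm_neg]
  have hd0 : A.natDegree ≠ 0 := by omega
  rcases lt_trichotomy ‖z‖ r with h | h | h
  · refine absurd h2 (ne_of_lt (norm_aeval_lt_of_mul_eq hA hd0 hroots ((mul_comm _ _).trans hmul) ?_))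
    rw [norm_div, norm_pow, Complex.norm_real, Real.norm_of_nonneg hr.le,
      lt_div_iff₀ (norm_pos_iff.2 hz0), sq]
    gcongr
  · exact h
  · exact absurd h2 (ne_of_gt (norm_aeval_lt_of_mul_eq hA hd0 hroots hmul h))

end selfRecip

/-- Many monic integer polynomials of degree `2 * l` with all roots on the circle of radius
`√R`. -/
theorem exists_circle_family (l : ℕ) : ∃ c : ℝ, 0 < c ∧ ∀ R : ℕ, 1 ≤ R → ∃ s : Finset ℤ[X],
    c * √R ^ tri l ≤ s.card ∧
      ∀ D ∈ s, D.Monic ∧ D.natDegree = 2 * l ∧ ∀ z ∈ D.aroots ℂ, ‖z‖ = √R := by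
  classical
  rcases Nat.eq_zero_or_pos l with rfl | hl
  -- In degree `0` the construction would give the constant `2`, which is not monic, so the constant
  -- `1` is used.
  · exact ⟨1, one_pos, fun R _ => ⟨{1}, by simp [tri], by simp⟩⟩
  · refine ⟨(1 / (l + 1 : ℝ)) ^ l, by positivity, fun R hR => ?_⟩
    have hr : 0 < √(R : ℝ) := Real.sqrt_pos.2 (by exact_mod_cast hR)
    refine ⟨(diskBox l √R).image (selfRecip R l), ?_, fun D hD => ?_⟩
    · rw [Finset.card_image_of_injective _ (selfRecip_injective _ _)]
      exact card_diskBox_ge l hr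
    · obtain ⟨A, hA, rfl⟩ := Finset.mem_image.1 hD
      obtain ⟨h1, h2, -⟩ := (mem_diskBox hr).1 hA
      exact ⟨monic_selfRecip hl h1 h2, natDegree_selfRecip hl h1 h2, fun z hz =>
        norm_root_selfRecip hl hr (by rw [Real.sq_sqrt (by positivity)]; simp) h1 h2
          (fun a ha => norm_lt_of_mem_diskBox hr hA ha) hz⟩

/-! ### Products of a circle factor and an inner factor. -/

theorem numRootsNorm_eq_natDegree {f : ℤ[X]} (hf : f.Monic) {r : ℝ}
    (h : ∀ z ∈ f.aroots ℂ, ‖z‖ = r) : numRootsNorm f r = f.natDegree := by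
  classical
  rw [numRootsNorm, Multiset.filter_eq_self.2 h, aroots,
    splits_iff_card_roots.1 (IsAlgClosed.splits _), hf.natDegree_map]

theorem numRootsNorm_eq_zero {f : ℤ[X]} {r : ℝ} (h : ∀ z ∈ f.aroots ℂ, ‖z‖ ≠ r) :
    numRootsNorm f r = 0 := by
  classical
  rw [numRootsNorm, Multiset.filter_eq_nil.2 h, Multiset.card_zero]

theorem exists_aroot {f : ℤ[X]} (hf : f.Monic) (hd : 1 ≤ f.natDegree) : ∃ z, z ∈ f.aroots ℂ := by
  refine Multiset.exists_mem_of_ne_zero ?_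
  rw [← Multiset.card_pos, aroots, splits_iff_card_roots.1 (IsAlgClosed.splits _), hf.natDegree_map]
  exact hd

theorem not_irreducible_mul_of_monic {g h : ℤ[X]} (hg : g.Monic) (hh : h.Monic)
    (hgd : 1 ≤ g.natDegree) (hhd : 1 ≤ h.natDegree) : ¬ Irreducible (g * h) := by
  intro hirr
  rcases hirr.isUnit_or_isUnit rfl with h | h
  · rw [hg.isUnit_iff.1 h, natDegree_one] at hgd
    omega
  · rw [hh.isUnit_iff.1 h, natDegree_one] at hhd
    omega

section product

variable {G h : ℤ[X]} {r : ℝ}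

theorem roots_mul_le (hG : G.Monic) (hh : h.Monic) (hGr : ∀ z ∈ G.aroots ℂ, ‖z‖ = r)
    (hhr : ∀ z ∈ h.aroots ℂ, ‖z‖ < r) : ∀ z ∈ (G * h).aroots ℂ, ‖z‖ ≤ r := by
  intro z hz
  rw [aroots_mul (hG.mul hh).ne_zero] at hz
  rcases Multiset.mem_add.1 hz with hz | hz
  · exact (hGr z hz).le
  · exact (hhr z hz).le

theorem exists_root_mul_norm_eq (hG : G.Monic) (hh : h.Monic) (hGd : 1 ≤ G.natDegree)
    (hGr : ∀ z ∈ G.aroots ℂ, ‖z‖ = r) : ∃ z ∈ (G * h).aroots ℂ, ‖z‖ = r := by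
  obtain ⟨z, hz⟩ := exists_aroot hG hGd
  refine ⟨z, ?_, hGr z hz⟩
  rw [aroots_mul (hG.mul hh).ne_zero]
  exact Multiset.mem_add.2 (Or.inl hz)

theorem numDominantRoots_mul (hG : G.Monic) (hh : h.Monic) (hGd : 1 ≤ G.natDegree)
    (hGr : ∀ z ∈ G.aroots ℂ, ‖z‖ = r) (hhr : ∀ z ∈ h.aroots ℂ, ‖z‖ < r) :
    numDominantRoots (G * h) = G.natDegree := by
  rw [numDominantRoots_eq (roots_mul_le hG hh hGr hhr) (exists_root_mul_norm_eq hG hh hGd hGr),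
    numRootsNorm_mul (hG.mul hh).ne_zero, numRootsNorm_eq_natDegree hG hGr,
    numRootsNorm_eq_zero fun z hz => (hhr z hz).ne, add_zero]

theorem mul_mem_dominantPolys (hG : G.Monic) (hh : h.Monic) (hGd : 1 ≤ G.natDegree)
    (hGr : ∀ z ∈ G.aroots ℂ, ‖z‖ = r) (hhr : ∀ z ∈ h.aroots ℂ, ‖z‖ < r) (hr : 1 ≤ r) {n H : ℕ}
    (hn : G.natDegree + h.natDegree = n) (hH : 2 ^ n * r ^ n ≤ (H : ℝ)) :
    G * h ∈ dominantPolys n G.natDegree H := by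
  have hd : (G * h).natDegree = n := by rw [hG.natDegree_mul hh, hn]
  refine ⟨hG.mul hh, hd, ?_, numDominantRoots_mul hG hh hGd hGr hhr⟩
  obtain ⟨i, hi⟩ := (G * h).exists_eq_supNorm
  rw [hi, Int.norm_eq_abs]
  refine (abs_coeff_le_of_roots (hG.mul hh) (by linarith) (roots_mul_le hG hh hGr hhr) i).trans
    (le_trans ?_ hH)
  rw [hd]
  gcongr
  omega

/-- The factor carrying the dominant roots can be recovered from the product. -/
theorem eq_of_mul_eq_mul_of_norm_roots {G' h' : ℤ[X]} (hG : G.Monic) (hh : h.Monic)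
    (hG' : G'.Monic) (hh' : h'.Monic) (hGr : ∀ z ∈ G.aroots ℂ, ‖z‖ = r)
    (hhr : ∀ z ∈ h.aroots ℂ, ‖z‖ < r) (hGr' : ∀ z ∈ G'.aroots ℂ, ‖z‖ = r)
    (hhr' : ∀ z ∈ h'.aroots ℂ, ‖z‖ < r) (he : G * h = G' * h') : G = G' ∧ h = h' := by
  classical
  have key : ∀ A B : ℤ[X], A.Monic → B.Monic → (∀ z ∈ A.aroots ℂ, ‖z‖ = r) →
      (∀ z ∈ B.aroots ℂ, ‖z‖ < r) →
      ((A * B).aroots ℂ).filter (fun z => ‖z‖ = r) = A.aroots ℂ := by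
    intro A B hA hB hAr hBr
    rw [aroots_mul (hA.mul hB).ne_zero, Multiset.filter_add, Multiset.filter_eq_self.2 hAr,
      Multiset.filter_eq_nil.2 fun z hz => (hBr z hz).ne, add_zero]
  have hroots : G.aroots ℂ = G'.aroots ℂ := by
    rw [← key G h hG hh hGr hhr, he, key G' h' hG' hh' hGr' hhr']
  have hGG : G = G' := by
    apply map_injective (algebraMap ℤ ℂ) (algebraMap ℤ ℂ).injective_int
    rw [(IsAlgClosed.splits (G.map (algebraMap ℤ ℂ))).eq_prod_roots_of_monic (hG.map _),
      (IsAlgClosed.splits (G'.map (algebraMap ℤ ℂ))).eq_prod_roots_of_monic (hG'.map _)]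
    exact congrArg (fun s => (Multiset.map (fun a => X - C a) s).prod) hroots
  subst hGG
  exact ⟨rfl, mul_left_cancel₀ hG.ne_zero he⟩

end product

/-- The products are `E * D * h` with `D` from the circle family and `h` with roots inside. The
factor `h` has no root on the circle, so the dominant roots give back `E * D`, and distinct pairs
`(D, h)` have distinct products. -/
theorem exists_dominant_family {e l q : ℕ}
    (hcond : 1 ≤ q ∧ 1 ≤ e + 2 * l ∨ 1 ≤ e ∧ 1 ≤ l) :
    ∃ c : ℝ, 0 < c ∧ ∀ R : ℕ, 1 ≤ R → ∀ E : ℤ[X], E.Monic → E.natDegree = e →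
      (∀ z ∈ E.aroots ℂ, ‖z‖ = √R) → ∃ s : Finset ℤ[X],
      c * √R ^ (tri l + tri q) ≤ s.card ∧ ∀ f ∈ s, ¬ Irreducible f ∧
        ((∀ z ∈ f.aroots ℂ, ‖z‖ ≤ √R) ∧ ∃ z ∈ f.aroots ℂ, ‖z‖ = √R) ∧
        ∀ H : ℕ, 2 ^ (e + 2 * l + q) * √R ^ (e + 2 * l + q) ≤ (H : ℝ) →
          f ∈ dominantPolys (e + 2 * l + q) (e + 2 * l) H := by
  classical
  obtain ⟨c, hc, hfam⟩ := exists_circle_family l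
  refine ⟨c * (1 / (q + 1 : ℝ)) ^ q, by positivity, fun R hR E hE hEd hEr => ?_⟩
  obtain ⟨s, hs, hs'⟩ := hfam R hR
  have hr1 : 1 ≤ √(R : ℝ) := Real.one_le_sqrt.2 (by exact_mod_cast hR)
  have hr : 0 < √(R : ℝ) := by linarith
  have hGprop : ∀ D ∈ s, (E * D).Monic ∧ (E * D).natDegree = e + 2 * l ∧
      ∀ z ∈ (E * D).aroots ℂ, ‖z‖ = √R := by
    intro D hD
    obtain ⟨h1, h2, h3⟩ := hs' D hD
    refine ⟨hE.mul h1, by rw [hE.natDegree_mul h1, hEd, h2], fun z hz => ?_⟩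
    rw [aroots_mul (hE.mul h1).ne_zero] at hz
    rcases Multiset.mem_add.1 hz with hz | hz
    · exact hEr z hz
    · exact h3 z hz
  have hhprop : ∀ h ∈ diskBox q √R, h.Monic ∧ h.natDegree = q ∧ ∀ z ∈ h.aroots ℂ, ‖z‖ < √R := by
    intro h hh
    obtain ⟨h1, h2, -⟩ := (mem_diskBox hr).1 hh
    exact ⟨h1, h2, fun z hz => norm_lt_of_mem_diskBox hr hh hz⟩
  refine ⟨(s ×ˢ diskBox q √R).image fun x => E * x.1 * x.2, ?_, fun f hf => ?_⟩
  · rw [Finset.card_image_of_injOn, Finset.card_product]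
    · push_cast
      calc c * (1 / (q + 1 : ℝ)) ^ q * √R ^ (tri l + tri q)
          = (c * √R ^ tri l) * ((1 / (q + 1 : ℝ)) ^ q * √R ^ tri q) := by rw [pow_add]; ring
        _ ≤ _ := by
          gcongr
          exact card_diskBox_ge q hr
    · rintro ⟨D, h⟩ hx ⟨D', h'⟩ hx' he
      obtain ⟨hD, hh⟩ := Finset.mem_product.1 hx
      obtain ⟨hD', hh'⟩ := Finset.mem_product.1 hx'
      obtain ⟨h1, -, h2⟩ := hGprop D hD
      obtain ⟨h3, -, h4⟩ := hGprop D' hD'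
      obtain ⟨h5, -, h6⟩ := hhprop h hh
      obtain ⟨h7, -, h8⟩ := hhprop h' hh'
      obtain ⟨h9, h10⟩ := eq_of_mul_eq_mul_of_norm_roots h1 h5 h3 h7 h2 h6 h4 h8 he
      exact Prod.ext (mul_left_cancel₀ hE.ne_zero h9) h10
  · obtain ⟨⟨D, h⟩, hx, rfl⟩ := Finset.mem_image.1 hf
    obtain ⟨hD, hh⟩ := Finset.mem_product.1 hx
    obtain ⟨h1, h2, h3⟩ := hGprop D hD
    obtain ⟨h4, h5, h6⟩ := hhprop h hh
    obtain ⟨h7, h8, -⟩ := hs' D hD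
    have hpos : 1 ≤ (E * D).natDegree := by omega
    refine ⟨?_, ⟨roots_mul_le h1 h4 h3 h6, exists_root_mul_norm_eq h1 h4 hpos h3⟩, fun H hH => ?_⟩
    -- The splitting is `(E * D) * h` when `h` is non-constant, and `E * (D * h)` when `E` and `D`
    -- are.
    · rcases hcond with hc | hc
      · exact not_irreducible_mul_of_monic h1 h4 hpos (by rw [h5]; omega)
      · rw [mul_assoc]
        refine not_irreducible_mul_of_monic hE (h7.mul h4) (by omega) ?_
        rw [h7.natDegree_mul h4]
        omega
    · have := mul_mem_dominantPolys h1 h4 hpos h3 h6 hr1 (n := e + 2 * l + q) (by rw [h2, h5]) hH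
      rwa [h2] at this

/-! ### Summation over the radii and the lower bounds. -/

theorem card_le_reducibleCount {n k H : ℕ} (s : Finset ℤ[X])
    (hs : ∀ f ∈ s, f ∈ dominantPolys n k H ∧ ¬ Irreducible f) : s.card ≤ reducibleCount n k H := by
  rw [← Set.ncard_coe_finset]
  exact Set.ncard_le_ncard hs ((dominantPolys_finite n k H).subset (Set.sep_subset _ _))

/-- The witness `(X ^ k - 1) * X ^ (n - k)`, divisible by `X - 1`, covers the small `H` for which
the families below are not available. -/
theorem one_le_reducibleCount {n k H : ℕ} (hn : 2 ≤ n) (hk : 1 ≤ k) (hkn : k ≤ n) (hH : 1 ≤ H) :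
    1 ≤ reducibleCount n k H := by
  have hG : (X ^ k - 1 : ℤ[X]).Monic := monic_X_pow_sub_C 1 (by omega)
  have hGd : (X ^ k - 1 : ℤ[X]).natDegree = k := natDegree_X_pow_sub_C
  have hh : (X ^ (n - k) : ℤ[X]).Monic := monic_X_pow _
  have hd : ((X ^ k - 1) * X ^ (n - k) : ℤ[X]).natDegree = n := by
    rw [hG.natDegree_mul hh, hGd, natDegree_X_pow]; omega
  have hGr : ∀ z ∈ (X ^ k - 1 : ℤ[X]).aroots ℂ, ‖z‖ = 1 := by
    intro z hz
    have h := (mem_aroots.1 hz).2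
    simp only [map_sub, map_pow, aeval_X, map_one, sub_eq_zero] at h
    exact Complex.norm_eq_one_of_pow_eq_one h (by omega)
  have hhr : ∀ z ∈ (X ^ (n - k) : ℤ[X]).aroots ℂ, ‖z‖ < 1 := by
    intro z hz
    have h := (mem_aroots.1 hz).2
    simp only [map_pow, aeval_X] at h
    rw [eq_zero_of_pow_eq_zero h, norm_zero]
    exact one_pos
  have hmem : ((X ^ k - 1) * X ^ (n - k) : ℤ[X]) ∈ dominantPolys n k H := by
    refine ⟨hG.mul hh, hd, ?_, (numDominantRoots_mul hG hh (by omega) hGr hhr).trans hGd⟩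
    obtain ⟨i, hi⟩ := ((X ^ k - 1) * X ^ (n - k) : ℤ[X]).exists_eq_supNorm
    rw [hi, Int.norm_eq_abs, sub_mul, ← pow_add, one_mul, coeff_sub, coeff_X_pow, coeff_X_pow]
    have hH' : (1 : ℝ) ≤ H := by exact_mod_cast hH
    split_ifs <;> simp <;> linarith
  have hirr : ¬ Irreducible ((X ^ k - 1) * X ^ (n - k) : ℤ[X]) := by
    obtain ⟨g, hg⟩ : (X - C 1 : ℤ[X]) ∣ (X ^ k - 1) * X ^ (n - k) := by
      rw [dvd_iff_isRoot]
      simp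
    have h1 : (X - C 1 : ℤ[X]).Monic := monic_X_sub_C 1
    have h2 : g.Monic := h1.of_mul_monic_left (hg ▸ hG.mul hh)
    rw [hg] at hd ⊢
    rw [h1.natDegree_mul h2, natDegree_X_sub_C] at hd
    exact not_irreducible_mul_of_monic h1 h2 (by rw [natDegree_X_sub_C]) (by omega)
  have := card_le_reducibleCount {(X ^ k - 1) * X ^ (n - k)} (fun f hf => by
    rw [Finset.mem_singleton.1 hf]
    exact ⟨hmem, hirr⟩)
  simpa using this

/-- Summing `exists_dominant_family` over the possible moduli `√(i ^ p)`. -/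
theorem exists_le_reducibleCount {e l q p : ℕ} (hp : 1 ≤ p) (hn : 2 ≤ e + 2 * l + q)
    (hcond : 1 ≤ q ∧ 1 ≤ e + 2 * l ∨ 1 ≤ e ∧ 1 ≤ l) (E : ℕ → ℤ[X])
    (hE : ∀ i, 1 ≤ i → (E i).Monic ∧ (E i).natDegree = e ∧
      ∀ z ∈ (E i).aroots ℂ, ‖z‖ = √((i ^ p : ℕ) : ℝ)) :
    ∃ c : ℝ, 0 < c ∧ ∀ H : ℕ, 1 ≤ H →
      c * (H : ℝ) ^ ((2 / (p : ℝ) + (tri l + tri q : ℕ)) / (e + 2 * l + q : ℕ)) ≤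
        reducibleCount (e + 2 * l + q) (e + 2 * l) H := by
  classical
  obtain ⟨c, hc, hfam⟩ := exists_dominant_family hcond
  set n := e + 2 * l + q
  set S := tri l + tri q
  have hn0 : (0 : ℝ) < n := by exact_mod_cast (by omega : 0 < n)
  have hp0 : (0 : ℝ) < p := by exact_mod_cast hp
  -- The radius is `i ^ (p / 2)`, so `i ≤ x ^ a` makes its `n`-th power at most `x = H / 2 ^ n`, as
  -- the height condition requires.
  set a : ℝ := 2 / (p * n)
  have ha : 0 < a := by positivity
  set ε : ℝ := (2 / (p : ℝ) + S) / n
  have hε : 0 ≤ ε := by positivity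
  have hsqrt : ∀ i : ℕ, √((i ^ p : ℕ) : ℝ) = (i : ℝ) ^ ((p : ℝ) / 2) := by
    intro i
    rw [Real.sqrt_eq_rpow, Nat.cast_pow, ← Real.rpow_natCast, ← Real.rpow_mul (by positivity)]
    congr 1; ring
  set c₁ : ℝ := c * (1 / 4) * ((1 / 4 : ℝ) ^ ((p : ℝ) / 2)) ^ S * (1 / 2 ^ n : ℝ) ^ ε
  set c₂ : ℝ := (1 / 2 ^ n : ℝ) ^ ε
  have hc₁ : 0 < c₁ := by positivity
  have hc₂ : 0 < c₂ := by positivity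
  refine ⟨min c₁ c₂, lt_min hc₁ hc₂, fun H hH => ?_⟩
  have hH0 : (0 : ℝ) < H := by exact_mod_cast hH
  set x : ℝ := H / 2 ^ n
  have hx0 : 0 < x := by positivity
  have hxε : x ^ ε = (H : ℝ) ^ ε * (1 / 2 ^ n : ℝ) ^ ε := by
    rw [← Real.mul_rpow (by positivity) (by positivity), mul_one_div]
  rcases lt_or_ge x 1 with hx | hx
  · calc min c₁ c₂ * (H : ℝ) ^ ε ≤ c₂ * (H : ℝ) ^ ε := by gcongr; exact min_le_right _ _
      _ = x ^ ε := by rw [hxε, mul_comm]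
      _ ≤ 1 := Real.rpow_le_one hx0.le hx.le hε
      _ ≤ _ := by
        exact_mod_cast one_le_reducibleCount hn (by omega) (by omega) hH
  set y : ℝ := x ^ a
  have hy : 1 ≤ y := Real.one_le_rpow hx ha.le
  set N := ⌊y⌋₊
  have hN1 : 1 ≤ N := Nat.floor_pos.2 hy
  have hNy : (N : ℝ) ≤ y := Nat.floor_le (by linarith)
  have hNy2 : y / 2 ≤ N := by
    have h1 : (1 : ℝ) ≤ N := by exact_mod_cast hN1
    linarith [Nat.lt_floor_add_one y]
  have hchoice : ∀ i : ℕ, ∃ s : Finset ℤ[X], 1 ≤ i →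
      (c * √((i ^ p : ℕ) : ℝ) ^ S ≤ s.card ∧ ∀ f ∈ s, ¬ Irreducible f ∧
        ((∀ z ∈ f.aroots ℂ, ‖z‖ ≤ √((i ^ p : ℕ) : ℝ)) ∧
          ∃ z ∈ f.aroots ℂ, ‖z‖ = √((i ^ p : ℕ) : ℝ)) ∧
        ∀ H : ℕ, 2 ^ n * √((i ^ p : ℕ) : ℝ) ^ n ≤ (H : ℝ) → f ∈ dominantPolys n (e + 2 * l) H) := by
    intro i
    by_cases hi : 1 ≤ i
    · obtain ⟨h1, h2, h3⟩ := hE i hi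
      obtain ⟨s, hs⟩ := hfam (i ^ p) (Nat.one_le_pow _ _ hi) (E i) h1 h2 h3
      exact ⟨s, fun _ => hs⟩
    · exact ⟨∅, fun h => absurd h hi⟩
  choose F hF using hchoice
  -- In the upper half of the range every `i`, and also the number of them, is at least `y / 4`.
  set I := Finset.Ioc (N / 2) N
  have hI : ∀ i ∈ I, 1 ≤ i ∧ y / 4 ≤ i ∧ (i : ℝ) ≤ y := by
    intro i hi
    obtain ⟨h1, h2⟩ := Finset.mem_Ioc.1 hi
    refine ⟨by omega, ?_, le_trans (by exact_mod_cast h2) hNy⟩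
    have h3 : (N : ℝ) ≤ 2 * i := by exact_mod_cast (by omega : N ≤ 2 * i)
    linarith
  have hcardI : y / 4 ≤ I.card := by
    rw [Nat.card_Ioc]
    have h3 : (N : ℝ) ≤ 2 * ((N - N / 2 : ℕ) : ℝ) := by
      exact_mod_cast (by omega : N ≤ 2 * (N - N / 2))
    linarith
  -- The maximal modulus of the roots of `f` determines `i`.
  have hdisj : Set.PairwiseDisjoint (I : Set ℕ) F := by
    intro i hi j hj hij
    refine Finset.disjoint_left.2 fun f hfi hfj => hij ?_
    obtain ⟨-, ⟨h1, z, hz, hz'⟩, -⟩ := (hF i (hI i hi).1).2 f hfi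
    obtain ⟨-, ⟨h2, w, hw, hw'⟩, -⟩ := (hF j (hI j hj).1).2 f hfj
    have h3 : √((i ^ p : ℕ) : ℝ) = √((j ^ p : ℕ) : ℝ) :=
      le_antisymm (hz' ▸ h2 z hz) (hw' ▸ h1 w hw)
    rw [Real.sqrt_inj (by positivity) (by positivity), Nat.cast_inj] at h3
    exact Nat.pow_left_injective (by omega : p ≠ 0) h3
  have hmem : ∀ f ∈ I.biUnion F, f ∈ dominantPolys n (e + 2 * l) H ∧ ¬ Irreducible f := by
    intro f hf
    obtain ⟨i, hi, hf⟩ := Finset.mem_biUnion.1 hf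
    obtain ⟨h1, -, h2⟩ := (hF i (hI i hi).1).2 f hf
    refine ⟨h2 H ?_, h1⟩
    have h3 : √((i ^ p : ℕ) : ℝ) ^ n ≤ x := by
      rw [hsqrt]
      calc ((i : ℝ) ^ ((p : ℝ) / 2)) ^ n ≤ (y ^ ((p : ℝ) / 2)) ^ n := by
            gcongr
            exact (hI i hi).2.2
        _ = x := by
            rw [← Real.rpow_natCast, ← Real.rpow_mul hx0.le, ← Real.rpow_mul hx0.le]
            have : a * (p / 2) * n = 1 := by simp only [a]; field_simp
            rw [this, Real.rpow_one]
    calc (2 : ℝ) ^ n * √((i ^ p : ℕ) : ℝ) ^ n ≤ 2 ^ n * x := by gcongr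
      _ = H := by simp only [x]; field_simp
  have hyε : y * (y ^ ((p : ℝ) / 2)) ^ S = x ^ ε := by
    rw [← Real.rpow_natCast, ← Real.rpow_mul hx0.le, ← Real.rpow_mul hx0.le, ← Real.rpow_add hx0]
    congr 1
    simp only [a, ε]
    field_simp
  calc min c₁ c₂ * (H : ℝ) ^ ε ≤ c₁ * (H : ℝ) ^ ε := by gcongr; exact min_le_left _ _
    _ = c * (1 / 4) * ((1 / 4 : ℝ) ^ ((p : ℝ) / 2)) ^ S * x ^ ε := by
        rw [hxε]; simp only [c₁]; ring
    _ = (y / 4) * (c * ((y / 4) ^ ((p : ℝ) / 2)) ^ S) := by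
        rw [← hyε, div_eq_mul_one_div y, Real.mul_rpow (by linarith) (by norm_num), mul_pow]
        ring
    _ ≤ I.card * (c * ((y / 4) ^ ((p : ℝ) / 2)) ^ S) := by gcongr
    _ = ∑ _i ∈ I, c * ((y / 4) ^ ((p : ℝ) / 2)) ^ S := by simp
    _ ≤ ∑ i ∈ I, ((F i).card : ℝ) := by
        refine Finset.sum_le_sum fun i hi => le_trans ?_ (hF i (hI i hi).1).1
        rw [hsqrt]
        gcongr
        exact (hI i hi).2.1
    _ = (I.biUnion F).card := by rw [Finset.card_biUnion hdisj]; push_cast; rfl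
    _ ≤ _ := by exact_mod_cast card_le_reducibleCount _ hmem

/-- An odd number of dominant roots is obtained from `E = X - i`, whose root has modulus `√R` for `R
= i ^ 2`; hence `p = 2`. If `q = 0`, then `n ≥ 3` gives `l ≥ 1`, so `E` is still a proper factor. -/
theorem exists_le_reducibleCount_odd {n k : ℕ} (hn : 3 ≤ n) (hkn : k ≤ n) (hk : Odd k) :
    ∃ c : ℝ, 0 < c ∧ ∀ H : ℕ, 1 ≤ H →
      c * (H : ℝ) ^ lowerExponent n k ≤ (reducibleCount n k H : ℝ) := by
  obtain ⟨l, rfl⟩ := id hk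
  obtain ⟨q, rfl⟩ := Nat.exists_eq_add_of_le hkn
  have hE : ∀ i : ℕ, 1 ≤ i → (X - C (i : ℤ) : ℤ[X]).Monic ∧ (X - C (i : ℤ) : ℤ[X]).natDegree = 1 ∧
      ∀ z ∈ (X - C (i : ℤ) : ℤ[X]).aroots ℂ, ‖z‖ = √((i ^ 2 : ℕ) : ℝ) := by
    intro i _
    refine ⟨monic_X_sub_C _, natDegree_X_sub_C _, fun z hz => ?_⟩
    have h := (mem_aroots.1 hz).2
    simp only [map_sub, aeval_X, aeval_C, sub_eq_zero] at h
    rw [h]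
    simp
  have := exists_le_reducibleCount (e := 1) (l := l) (q := q) one_le_two (by omega) (by omega) _ hE
  have hexp : lowerExponent (2 * l + 1 + q) (2 * l + 1) =
      (2 / ((2 : ℕ) : ℝ) + (tri l + tri q : ℕ)) / (1 + 2 * l + q : ℕ) := by
    rw [lowerExponent, if_pos hk]
    push_cast
    rw [cast_tri, cast_tri]
    have : (2 * (l : ℝ) + 1 + q) ≠ 0 := by positivity
    have : (1 + 2 * (l : ℝ) + q) ≠ 0 := by positivity
    field_simp
    ring
  rw [hexp, show 2 * l + 1 = 1 + 2 * l by ring]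
  exact this

/-- Here `E = 1`, so every integer `R` is allowed and `p = 1`. Reducibility comes from the inner
factor, which is non-constant because `k < n`. -/
theorem exists_le_reducibleCount_even {n k : ℕ} (hk1 : 1 ≤ k) (hkn : k < n) (hk : Even k) :
    ∃ c : ℝ, 0 < c ∧ ∀ H : ℕ, 1 ≤ H →
      c * (H : ℝ) ^ lowerExponent n k ≤ (reducibleCount n k H : ℝ) := by
  obtain ⟨l, rfl⟩ := hk.two_dvd
  obtain ⟨q, rfl⟩ := Nat.exists_eq_add_of_le hkn.le
  have := exists_le_reducibleCount (e := 0) (l := l) (q := q) le_rfl (by omega) (by omega)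
    (fun _ => 1) (fun i _ => ⟨monic_one, natDegree_one, by simp⟩)
  have hexp : lowerExponent (2 * l + q) (2 * l) =
      (2 / ((1 : ℕ) : ℝ) + (tri l + tri q : ℕ)) / (0 + 2 * l + q : ℕ) := by
    rw [lowerExponent, if_neg (Nat.not_odd_iff_even.2 hk)]
    push_cast
    rw [cast_tri, cast_tri]
    have : (2 * (l : ℝ) + q) ≠ 0 := by
      have : (1 : ℝ) ≤ q := by exact_mod_cast (by omega : 1 ≤ q)
      positivity
    have : (0 + 2 * (l : ℝ) + q) ≠ 0 := by rwa [zero_add]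
    field_simp
    ring
  rw [hexp]
  simpa only [zero_add] using this

/-- There is no inner factor, so reducibility is forced by `E = X ^ 2 - i`. This uses up two of the
`n` roots and leaves `l = n / 2 - 1` for the circle family. -/
theorem exists_le_reducibleCount_self {n : ℕ} (hn : 3 ≤ n) (he : Even n) :
    ∃ c : ℝ, 0 < c ∧ ∀ H : ℕ, 1 ≤ H →
      c * (H : ℝ) ^ ((n : ℝ) / 8 + 2 / (n : ℝ) - 1 / 4) ≤ (reducibleCount n n H : ℝ) := by
  obtain ⟨l, rfl⟩ : ∃ l, n = 2 + 2 * l := by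
    obtain ⟨m, rfl⟩ := he.two_dvd
    exact ⟨m - 1, by omega⟩
  have hE : ∀ i : ℕ, 1 ≤ i → (X ^ 2 - C (i : ℤ) : ℤ[X]).Monic ∧
      (X ^ 2 - C (i : ℤ) : ℤ[X]).natDegree = 2 ∧
      ∀ z ∈ (X ^ 2 - C (i : ℤ) : ℤ[X]).aroots ℂ, ‖z‖ = √((i ^ 1 : ℕ) : ℝ) := by
    intro i _
    refine ⟨monic_X_pow_sub_C _ two_ne_zero, natDegree_X_pow_sub_C, fun z hz => ?_⟩
    have h := (mem_aroots.1 hz).2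
    simp only [map_sub, map_pow, aeval_X, aeval_C, sub_eq_zero] at h
    have h2 := congrArg norm h
    rw [norm_pow] at h2
    rw [pow_one, ← Real.sqrt_sq (norm_nonneg z), h2]
    simp
  have := exists_le_reducibleCount (e := 2) (l := l) (q := 0) le_rfl (by omega) (by omega) _ hE
  have hexp : ((2 + 2 * l : ℕ) : ℝ) / 8 + 2 / ((2 + 2 * l : ℕ) : ℝ) - 1 / 4 =
      (2 / ((1 : ℕ) : ℝ) + (tri l + tri 0 : ℕ)) / (2 + 2 * l + 0 : ℕ) := by
    push_cast
    rw [cast_tri, cast_tri]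
    have : (2 + 2 * (l : ℝ)) ≠ 0 := by positivity
    push_cast
    field_simp
    ring
  rw [hexp]
  simpa only [add_zero] using this

/-! ### Degree two. -/

/-- The monic quadratic polynomial with roots `-a` and `-b`. -/
noncomputable def splitQuad (a b : ℤ) : ℤ[X] := (X + C a) * (X + C b)

theorem monic_splitQuad (a b : ℤ) : (splitQuad a b).Monic :=
  (monic_X_add_C a).mul (monic_X_add_C b)

theorem natDegree_splitQuad (a b : ℤ) : (splitQuad a b).natDegree = 2 := by
  rw [splitQuad, (monic_X_add_C a).natDegree_mul (monic_X_add_C b), natDegree_X_add_C,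
    natDegree_X_add_C]

theorem splitQuad_comm (a b : ℤ) : splitQuad a b = splitQuad b a := mul_comm _ _

theorem splitQuad_eq (a b : ℤ) : splitQuad a b = X ^ 2 + C (a + b) * X + C (a * b) := by
  rw [splitQuad, C_add, C_mul]; ring

theorem coeff_zero_splitQuad (a b : ℤ) : (splitQuad a b).coeff 0 = a * b := by
  simp [splitQuad_eq, mul_coeff_zero]

theorem coeff_one_splitQuad (a b : ℤ) : (splitQuad a b).coeff 1 = a + b := by
  rw [splitQuad_eq, coeff_add, coeff_add, coeff_X_pow, coeff_C_mul_X, coeff_C]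
  simp

theorem not_irreducible_splitQuad (a b : ℤ) : ¬ Irreducible (splitQuad a b) :=
  not_irreducible_mul_of_monic (monic_X_add_C a) (monic_X_add_C b) (by rw [natDegree_X_add_C])
    (by rw [natDegree_X_add_C])

theorem supNorm_splitQuad_le {a b : ℤ} {H : ℕ} (hH : 1 ≤ H) (h0 : |a * b| ≤ H) (h1 : |a + b| ≤ H) :
    (splitQuad a b).supNorm ≤ (H : ℝ) := by
  obtain ⟨i, hi⟩ := (splitQuad a b).exists_eq_supNorm
  rw [hi, Int.norm_eq_abs]
  have key : |(splitQuad a b).coeff i| ≤ (H : ℤ) := by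
    rcases lt_trichotomy i 2 with h | rfl | h
    · interval_cases i
      · rwa [coeff_zero_splitQuad]
      · rwa [coeff_one_splitQuad]
    · rw [← natDegree_splitQuad a b, (monic_splitQuad a b).coeff_natDegree, abs_one]
      exact_mod_cast hH
    · rw [coeff_eq_zero_of_natDegree_lt (by rwa [natDegree_splitQuad]), abs_zero]
      positivity
  exact_mod_cast key

theorem norm_root_X_add_C {a : ℤ} {z : ℂ} (hz : z ∈ (X + C a : ℤ[X]).aroots ℂ) :
    ‖z‖ = |(a : ℝ)| := by
  have h := (mem_aroots.1 hz).2
  simp only [map_add, aeval_X, aeval_C] at h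
  rw [eq_neg_of_add_eq_zero_left h, norm_neg]
  simp

theorem numDominantRoots_splitQuad (a b : ℤ) :
    numDominantRoots (splitQuad a b) = if |a| = |b| then 2 else 1 := by
  have key : ∀ a b : ℤ, |b| < |a| → numDominantRoots (splitQuad a b) = 1 := by
    intro a b h
    have h' : |(b : ℝ)| < |(a : ℝ)| := by exact_mod_cast h
    rw [splitQuad, numDominantRoots_mul (r := |(a : ℝ)|) (monic_X_add_C a) (monic_X_add_C b)
      (by rw [natDegree_X_add_C]) (fun z hz => norm_root_X_add_C hz)
      (fun z hz => (norm_root_X_add_C hz).trans_lt h'), natDegree_X_add_C]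
  split_ifs with h
  · have h' : |(a : ℝ)| = |(b : ℝ)| := by exact_mod_cast h
    have hr : ∀ z ∈ (splitQuad a b).aroots ℂ, ‖z‖ = |(a : ℝ)| := by
      intro z hz
      rw [splitQuad, aroots_mul (monic_splitQuad a b).ne_zero] at hz
      rcases Multiset.mem_add.1 hz with hz | hz
      · exact norm_root_X_add_C hz
      · rw [h']
        exact norm_root_X_add_C hz
    obtain ⟨z, hz⟩ := exists_aroot (monic_splitQuad a b) (by rw [natDegree_splitQuad]; omega)
    rw [numDominantRoots_eq (fun z hz => (hr z hz).le) ⟨z, hz, hr z hz⟩,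
      numRootsNorm_eq_natDegree (monic_splitQuad a b) hr, natDegree_splitQuad]
  · rcases lt_or_gt_of_ne h with h | h
    · rw [splitQuad_comm]
      exact key b a h
    · exact key a b h

theorem splitQuad_mem {a b : ℤ} {H k : ℕ} (hH : 1 ≤ H) (h0 : |a * b| ≤ H) (h1 : |a + b| ≤ H)
    (hk : (if |a| = |b| then 2 else 1) = k) :
    splitQuad a b ∈ dominantPolys 2 k H ∧ ¬ Irreducible (splitQuad a b) :=
  ⟨⟨monic_splitQuad a b, natDegree_splitQuad a b, supNorm_splitQuad_le hH h0 h1,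
    (numDominantRoots_splitQuad a b).trans hk⟩, not_irreducible_splitQuad a b⟩

theorem exists_splitQuad {f : ℤ[X]} {H k : ℕ} (hf : f ∈ dominantPolys 2 k H)
    (hirr : ¬ Irreducible f) : ∃ a b : ℤ, f = splitQuad a b ∧ |b| ≤ |a| ∧ |a * b| ≤ H ∧
      |a + b| ≤ H ∧ (if |a| = |b| then 2 else 1) = k := by
  obtain ⟨hm, hd, hs, hk⟩ := hf
  obtain ⟨a, b, h0, h1⟩ := (hm.not_irreducible_iff_exists_add_mul_eq_coeff hd).1 hirr
  have hfab : f = splitQuad a b := by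
    rw [splitQuad_eq, hm.as_sum, hd, Finset.sum_range_succ, Finset.sum_range_one, h0, h1]
    ring
  have hc : ∀ i, |f.coeff i| ≤ (H : ℤ) := by
    intro i
    have := (f.le_supNorm i).trans hs
    rw [Int.norm_eq_abs] at this
    exact_mod_cast this
  have hc0 := hc 0
  have hc1 := hc 1
  rw [h0] at hc0
  rw [h1] at hc1
  rw [hfab, numDominantRoots_splitQuad] at hk
  rcases le_total |b| |a| with h | h
  · exact ⟨a, b, hfab, h, hc0, hc1, hk⟩
  · exact ⟨b, a, hfab.trans (splitQuad_comm a b), h, by rwa [mul_comm], by rwa [add_comm],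
      by simpa only [eq_comm] using hk⟩

theorem reducibleCount_two_le {k H : ℕ} (s : Finset (ℤ × ℤ))
    (hs : ∀ a b : ℤ, |b| ≤ |a| → |a * b| ≤ H → |a + b| ≤ H →
      (if |a| = |b| then 2 else 1) = k → (a, b) ∈ s) : reducibleCount 2 k H ≤ s.card := by
  classical
  have : {f ∈ dominantPolys 2 k H | ¬ Irreducible f} ⊆
      ((s.image fun x => splitQuad x.1 x.2 : Finset ℤ[X]) : Set ℤ[X]) := by
    rintro f ⟨h1, h2⟩
    obtain ⟨a, b, rfl, h3, h4, h5, h6⟩ := exists_splitQuad h1 h2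
    exact Finset.mem_coe.2 (Finset.mem_image.2 ⟨(a, b), hs a b h3 h4 h5 h6, rfl⟩)
  calc reducibleCount 2 k H ≤ (s.image fun x => splitQuad x.1 x.2).card := by
        rw [← Set.ncard_coe_finset]
        exact Set.ncard_le_ncard this (Finset.finite_toSet _)
    _ ≤ s.card := Finset.card_image_le

theorem sum_inv_eq_harmonic (H : ℕ) : ∑ b ∈ Finset.Icc 1 H, ((b : ℝ))⁻¹ = (harmonic H : ℝ) := by
  rw [harmonic_eq_sum_Icc]
  push_cast
  rfl

theorem reducibleCount_two_one_le {H : ℕ} (hH : 2 ≤ H) :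
    (reducibleCount 2 1 H : ℝ) ≤ (9 / Real.log 2 + 6) * (H * Real.log H) := by
  classical
  have hH0 : (2 : ℝ) ≤ H := by exact_mod_cast hH
  -- For `b = 0` the bound on `a + b` limits `a`; for `b ≠ 0` it is `|a| ≤ H / |b|`. The second part
  -- leads to the harmonic sum.
  set s : Finset (ℤ × ℤ) := (Finset.Icc (-(H : ℤ)) H) ×ˢ {0} ∪ (Finset.Icc 1 H).biUnion fun b =>
    (Finset.Icc (-((H / b : ℕ) : ℤ)) (H / b : ℕ)) ×ˢ {(b : ℤ), -(b : ℤ)}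
  have h1 : reducibleCount 2 1 H ≤ s.card := by
    refine reducibleCount_two_le s fun a b hab h0 h1 _ => ?_
    rcases eq_or_ne b 0 with rfl | hb
    · rw [add_zero] at h1
      refine Finset.mem_union_left _ (Finset.mem_product.2 ⟨?_, by simp⟩)
      exact Finset.mem_Icc.2 (abs_le.1 h1)
    · refine Finset.mem_union_right _ (Finset.mem_biUnion.2 ⟨b.natAbs, ?_, ?_⟩)
      · have hb1 : 1 ≤ |b| := Int.one_le_abs hb
        have : |b| ≤ H := by
          rw [abs_mul] at h0
          nlinarith
        rw [Int.abs_eq_natAbs] at hb1 this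
        rw [Finset.mem_Icc]
        omega
      · refine Finset.mem_product.2 ⟨?_, ?_⟩
        · refine Finset.mem_Icc.2 (abs_le.1 ?_)
          rw [← Int.natCast_natAbs, Nat.cast_le, Nat.le_div_iff_mul_le (Int.natAbs_pos.2 hb),
            ← Int.natAbs_mul]
          rw [← Int.natCast_natAbs] at h0
          exact_mod_cast h0
        · simp only [Finset.mem_insert, Finset.mem_singleton]
          omega
  have h2 : (s.card : ℝ) ≤ (2 * H + 1) + ∑ b ∈ Finset.Icc 1 H, 6 * (H * (b : ℝ)⁻¹) := by
    calc (s.card : ℝ) ≤ ((2 * H + 1 + ∑ b ∈ Finset.Icc 1 H, (2 * (H / b) + 1) * 2 : ℕ) : ℝ) := by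
          refine Nat.cast_le.2 ((Finset.card_union_le _ _).trans (add_le_add ?_
            (Finset.card_biUnion_le.trans (Finset.sum_le_sum fun b _ => ?_))))
          · rw [Finset.card_product, Int.card_Icc, Finset.card_singleton]
            omega
          · rw [Finset.card_product, Int.card_Icc]
            refine Nat.mul_le_mul (by omega) Finset.card_le_two
      _ ≤ _ := by
          push_cast
          refine add_le_add_right (Finset.sum_le_sum fun b hb => ?_) _
          obtain ⟨hb1, hb2⟩ := Finset.mem_Icc.1 hb
          have hb0 : (0 : ℝ) < b := by exact_mod_cast hb1
          have h3 : ((H / b : ℕ) : ℝ) ≤ H * (b : ℝ)⁻¹ := Nat.cast_div_le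
          have h4 : 1 ≤ H * (b : ℝ)⁻¹ := by
            rw [← div_eq_mul_inv, one_le_div hb0]
            exact_mod_cast hb2
          linarith
  have h3 : (harmonic H : ℝ) ≤ 1 + Real.log H := harmonic_le_one_add_log H
  rw [← Finset.mul_sum, ← Finset.mul_sum, sum_inv_eq_harmonic] at h2
  have hlog2 : 0 < Real.log 2 := Real.log_pos one_lt_two
  have hlog : Real.log 2 ≤ Real.log H := Real.log_le_log two_pos hH0
  have h4 : 1 ≤ Real.log H / Real.log 2 := by rwa [one_le_div hlog2]
  calc (reducibleCount 2 1 H : ℝ) ≤ s.card := by exact_mod_cast h1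
    _ ≤ (2 * H + 1) + 6 * (H * (1 + Real.log H)) := h2.trans (by gcongr)
    -- Here `2 * H + 1 ≤ 3 * H`, and the linear term is then absorbed using `log H ≥ log 2`.
    _ ≤ 9 * H * 1 + 6 * (H * Real.log H) := by linarith
    _ ≤ 9 * H * (Real.log H / Real.log 2) + 6 * (H * Real.log H) := by gcongr
    _ = _ := by ring

/-- The polynomials `(X - a) * (X + b)` with `a, b ≥ 1` are used: the opposite signs of the roots
make `(a, b)` recoverable, and `|a + b|` in `splitQuad` becomes `|b - a| ≤ H`. The pairs `a = b` are
removed, since they have two dominant roots. -/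
theorem le_reducibleCount_two_one {H : ℕ} (hH : 2 ≤ H) :
    1 / 4 * (H * Real.log H) ≤ (reducibleCount 2 1 H : ℝ) := by
  classical
  set s : Finset (Σ _ : ℕ, ℕ) := (Finset.Icc 1 H).sigma fun a => (Finset.Icc 1 (H / a)).erase a
  have hs : ∀ x ∈ s, 1 ≤ x.1 ∧ 1 ≤ x.2 ∧ x.1 ≠ x.2 ∧ x.1 * x.2 ≤ H := by
    intro x hx
    obtain ⟨h1, h2⟩ := Finset.mem_sigma.1 hx
    obtain ⟨h3, h4⟩ := Finset.mem_erase.1 h2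
    rw [Finset.mem_Icc] at h1 h4
    exact ⟨h1.1, h4.1, h3.symm, by
      rw [mul_comm]; exact (Nat.le_div_iff_mul_le h1.1).1 h4.2⟩
  have hcard : s.card ≤ reducibleCount 2 1 H := by
    rw [← Finset.card_image_of_injOn (f := fun x : Σ _ : ℕ, ℕ => splitQuad (-(x.1 : ℤ)) x.2)]
    · refine card_le_reducibleCount _ fun f hf => ?_
      obtain ⟨⟨a, b⟩, hx, rfl⟩ := Finset.mem_image.1 hf
      obtain ⟨ha, hb, hab, hH'⟩ := hs _ hx
      simp only at ha hb hab hH'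
      refine splitQuad_mem (by omega) ?_ ?_ ?_
      · rw [neg_mul, abs_neg, abs_of_nonneg (by positivity)]
        exact_mod_cast hH'
      · have h1 : a ≤ H := le_trans (Nat.le_mul_of_pos_right a hb) hH'
        have h2 : b ≤ H := le_trans (Nat.le_mul_of_pos_left b ha) hH'
        simp only [abs_le]
        omega
      · rw [if_neg]
        rw [abs_neg, Nat.abs_cast, Nat.abs_cast]
        exact_mod_cast hab
    · rintro ⟨a, b⟩ hx ⟨a', b'⟩ hx' he
      obtain ⟨ha, hb, -, -⟩ := hs _ hx
      obtain ⟨ha', hb', -, -⟩ := hs _ hx'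
      simp only at ha hb ha' hb' he
      have h0 := congrArg (fun f => coeff f 0) he
      have h1 := congrArg (fun f => coeff f 1) he
      simp only [coeff_zero_splitQuad, coeff_one_splitQuad] at h0 h1
      have h2 : ((a : ℤ) - a') * (a + b') = 0 := by linear_combination -h0 - a * h1
      have h3 : (a : ℤ) = a' := by
        rcases mul_eq_zero.1 h2 with h | h
        · linarith
        · omega
      have h4 : (b : ℤ) = b' := by linarith
      obtain rfl : a = a' := by exact_mod_cast h3
      obtain rfl : b = b' := by exact_mod_cast h4
      rfl
  have hterm : ∀ a ∈ Finset.Icc 1 H,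
      1 / 4 * (H * (a : ℝ)⁻¹) ≤ (((Finset.Icc 1 (H / a)).erase a).card : ℝ) := by
    intro a ha
    obtain ⟨ha1, ha2⟩ := Finset.mem_Icc.1 ha
    have ha0 : (0 : ℝ) < a := by exact_mod_cast ha1
    have hq : 1 ≤ H / a := (Nat.le_div_iff_mul_le ha1).2 (by omega)
    have h1 : (H : ℝ) * (a : ℝ)⁻¹ ≤ 2 * (H / a : ℕ) := by
      rw [← div_eq_mul_inv, div_le_iff₀ ha0]
      have h2 := Nat.lt_div_mul_add (a := H) ha1
      have h3 : H ≤ 2 * (H / a) * a := by nlinarith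
      exact_mod_cast h3
    -- Removing one element costs at most half, because it occurs only if `H / a ≥ 2`; for `a = 1`
    -- this uses `H ≥ 2`. Rounding down `H / a` costs the other factor `2` in the constant `1 / 4`.
    have h2 : H / a ≤ 2 * ((Finset.Icc 1 (H / a)).erase a).card := by
      by_cases hmem : a ∈ Finset.Icc 1 (H / a)
      · rw [Finset.card_erase_of_mem hmem, Nat.card_Icc]
        have h4 := (Finset.mem_Icc.1 hmem).2
        have h5 : 2 ≤ H / a := by
          rcases Nat.lt_or_ge a 2 with h | h
          · obtain rfl : a = 1 := by omega
            simpa using hH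
          · omega
        omega
      · rw [Finset.erase_eq_of_notMem hmem, Nat.card_Icc]
        omega
    have h3 : ((H / a : ℕ) : ℝ) ≤ 2 * (((Finset.Icc 1 (H / a)).erase a).card : ℝ) := by
      exact_mod_cast h2
    linarith
  have hH0 : (2 : ℝ) ≤ H := by exact_mod_cast hH
  calc 1 / 4 * (H * Real.log H) ≤ 1 / 4 * (H * (harmonic H : ℝ)) := by
        gcongr
        refine le_trans ?_ (log_add_one_le_harmonic H)
        refine Real.log_le_log (by linarith) ?_
        push_cast
        linarith
    _ = ∑ a ∈ Finset.Icc 1 H, 1 / 4 * (H * (a : ℝ)⁻¹) := by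
        rw [← Finset.mul_sum, ← Finset.mul_sum, sum_inv_eq_harmonic]
    _ ≤ ∑ a ∈ Finset.Icc 1 H, (((Finset.Icc 1 (H / a)).erase a).card : ℝ) :=
        Finset.sum_le_sum hterm
    _ = s.card := by rw [Finset.card_sigma]; push_cast; rfl
    _ ≤ _ := by exact_mod_cast hcard

theorem reducibleCount_two_two_le {H : ℕ} (hH : 1 ≤ H) :
    (reducibleCount 2 2 H : ℝ) ≤ 6 * (H : ℝ) ^ (1 / 2 : ℝ) := by
  classical
  set r := Nat.sqrt H
  have hr : 1 ≤ r := Nat.sqrt_pos.2 hH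
  have h1 : reducibleCount 2 2 H ≤ (2 * r + 1) * 2 := by
    -- Two dominant roots mean `b = ±a`, so `a ^ 2 ≤ H` and each `a` gives at most two pairs.
    refine (reducibleCount_two_le ((Finset.Icc (-(r : ℤ)) r).biUnion fun a => {(a, a), (a, -a)})
      fun a b _ h0 _ hk => ?_).trans ?_
    · have hab : |a| = |b| := by
        by_contra h
        rw [if_neg h] at hk
        omega
      refine Finset.mem_biUnion.2 ⟨a, Finset.mem_Icc.2 (abs_le.1 ?_), ?_⟩
      · rw [← Int.natCast_natAbs, Nat.cast_le, Nat.le_sqrt]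
        rw [abs_mul, ← hab, ← Int.natCast_natAbs] at h0
        exact_mod_cast h0
      · rcases abs_eq_abs.1 hab with rfl | rfl <;> simp
    · refine (Finset.card_biUnion_le_card_mul _ _ 2 fun a _ => Finset.card_le_two).trans
        (le_of_eq ?_)
      rw [Int.card_Icc]
      congr 1
      omega
  have h2 : (reducibleCount 2 2 H : ℝ) ≤ 6 * r := by exact_mod_cast (by omega)
  rw [← Real.sqrt_eq_rpow]
  exact h2.trans (by gcongr; exact Real.nat_sqrt_le_real_sqrt)

theorem le_reducibleCount_two_two {H : ℕ} (hH : 1 ≤ H) :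
    1 / 2 * (H : ℝ) ^ (1 / 2 : ℝ) ≤ (reducibleCount 2 2 H : ℝ) := by
  classical
  set r := Nat.sqrt H
  have hr : 1 ≤ r := Nat.sqrt_pos.2 hH
  have hcard : r ≤ reducibleCount 2 2 H := by
    have : ((Finset.Icc 1 r).image fun a : ℕ => splitQuad a (-(a : ℤ))).card = r := by
      rw [Finset.card_image_of_injective, Nat.card_Icc, Nat.add_sub_cancel]
      intro a b h
      have h0 := congrArg (fun f => coeff f 0) h
      simp only [coeff_zero_splitQuad, mul_neg, neg_inj] at h0
      have h1 : a * a = b * b := by exact_mod_cast h0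
      exact Nat.mul_self_inj.1 h1
    rw [← this]
    refine card_le_reducibleCount _ fun f hf => ?_
    obtain ⟨a, ha, rfl⟩ := Finset.mem_image.1 hf
    have h1 : a * a ≤ H := Nat.le_sqrt.1 (Finset.mem_Icc.1 ha).2
    refine splitQuad_mem hH ?_ ?_ (if_pos (abs_neg _).symm)
    · rw [mul_neg, abs_neg, abs_of_nonneg (by positivity)]
      exact_mod_cast h1
    · simp
  rw [← Real.sqrt_eq_rpow]
  have h1 : √(H : ℝ) < r + 1 := Real.real_sqrt_lt_nat_sqrt_succ
  have h2 : (1 : ℝ) ≤ r := by exact_mod_cast hr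
  have h3 : (r : ℝ) ≤ reducibleCount 2 2 H := by exact_mod_cast hcard
  linarith

theorem theorem1p3 :
    (∃ c C : ℝ, 0 < c ∧ 0 < C ∧ ∀ H : ℕ, 2 ≤ H →
      c * ((H : ℝ) * Real.log H) ≤ (reducibleCount 2 1 H : ℝ) ∧
      (reducibleCount 2 1 H : ℝ) ≤ C * ((H : ℝ) * Real.log H)) ∧
    (∃ c C : ℝ, 0 < c ∧ 0 < C ∧ ∀ H : ℕ, 1 ≤ H →
      c * (H : ℝ) ^ (1 / 2 : ℝ) ≤ (reducibleCount 2 2 H : ℝ) ∧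
      (reducibleCount 2 2 H : ℝ) ≤ C * (H : ℝ) ^ (1 / 2 : ℝ)) ∧
    (∀ n k : ℕ, 3 ≤ n → 1 ≤ k → k ≤ n →
      (∃ C : ℝ, 0 < C ∧ ∀ H : ℕ, 1 ≤ H →
        (reducibleCount n k H : ℝ) ≤ C * (H : ℝ) ^ ((n : ℝ) - ((k : ℝ) + 1) / 2)) ∧
      (¬ (k = n ∧ Even n) →
        ∃ c : ℝ, 0 < c ∧ ∀ H : ℕ, 1 ≤ H →
          c * (H : ℝ) ^ lowerExponent n k ≤ (reducibleCount n k H : ℝ)) ∧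
      (k = n ∧ Even n →
        ∃ c : ℝ, 0 < c ∧ ∀ H : ℕ, 1 ≤ H →
          c * (H : ℝ) ^ ((n : ℝ) / 8 + 2 / (n : ℝ) - 1 / 4) ≤ (reducibleCount n n H : ℝ))) := by
  refine ⟨⟨1 / 4, 9 / Real.log 2 + 6, by norm_num, ?_, fun H hH =>
      ⟨le_reducibleCount_two_one hH, reducibleCount_two_one_le hH⟩⟩,
    ⟨1 / 2, 6, by norm_num, by norm_num, fun H hH =>
      ⟨le_reducibleCount_two_two hH, reducibleCount_two_two_le hH⟩⟩,
    fun n k hn hk hkn => ⟨reducibleCount_le hn hk, fun h => ?_, fun h => ?_⟩⟩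
  · have : 0 < Real.log 2 := Real.log_pos one_lt_two
    positivity
  · rcases Nat.even_or_odd k with he | ho
    · refine exists_le_reducibleCount_even hk (lt_of_le_of_ne hkn ?_) he
      rintro rfl
      exact h ⟨rfl, he⟩
    · exact exists_le_reducibleCount_odd hn hkn ho
  · exact exists_le_reducibleCount_self hn h.2
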